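/- Let $P$ be the partially ordered set of nonempty finite subsets of $\{1,2,3,\dots\}$ (ordered by inclusion) and, for $n\ge 1$, let $P^n\subset P$ consist of the nonempty subsets of $\{1,\dots,n\}$. Let $\Delta$ be the category of the ordered sets $[q]=\{0<\dots<q\}$, $q\ge 0$, and order-preserving maps, and let $\Delta^{<n}\subset\Delta$ be the full subcategory on the objects $[q]$ with $q<n$. Let $f\colon P\to\Delta$ be the functor that sends $T=\{t_0<\dots<t_q\}$ to $[q]$ and sends the inclusion $T\setminus\{t_i\}\subset T$ to the coface map $\delta^i\colon[q-1]\to[q]$ (so an inclusion $T\subseteq T'$ goes to the order-preserving injection that it induces on indices), and let $f^n\colon P^n\to\Delta^{<n}$ be its restriction. A functor $F\colon D\to C$ of small categories is called left cofinal if for each object $c$ of $C$ the left fiber $F/c$, with objects the pairs $(d,\,F(d)\to c)$, has contractible nerve. Then the following hold. 1. The functors $f\colon P\to\Delta$ and $f^n\colon P^n\to\Delta^{<n}$, for all $n\ge 1$, are left cofinal. 2. For every cosimplicial spectrum $Y^\bullet\colon\Delta\to\mathrm{Sp}$ the canonical map $$f^*\colon \operatorname{holim}_{\Delta} Y^\bullet\longrightarrow\operatorname{holim}_{P}\,(Y^\bullet\circ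 f)$$ is a stable equivalence of spectra. 3. For every $n\ge 1$ and every $(n-1)$-truncated cosimplicial spectrum $Y^\bullet_{<n}\colon\Delta^{<n}\to\mathrm{Sp}$ the canonical map $$f_n^*\colon \operatorname{holim}_{\Delta^{<n}} Y_{<n}^\bullet\longrightarrow\operatorname{holim}_{P^n}\,(Y_{<n}^\bullet\circ f^n)$$ is a stable equivalence of spectra. Here $\mathrm{Sp}$ is the category of Bousfield--Friedlander spectra of simplicial sets; $\operatorname{holim}$ is the Bousfield--Kan homotopy limit, formed levelwise, of the diagram obtained by first replacing each vertex, naturally in the diagram, by a fibrant spectrum (an $\Omega$-spectrum whose levels are Kan complexes) through stable equivalences; 2 and 3 hold for every choice of such a replacement. A stable equivalence is a map that induces isomorphisms on all stable homotopy groups. -/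

import Mathlib

open CategoryTheory Simplicial MonoidalCategory Opposite

namespace CosimplicialDescent

noncomputable section

/-! ### Weak equivalences of simplicial sets and pointed simplicial sets -/

/-- A map `f : A ⟶ B` of simplicial sets is a weak homotopy equivalence if for every Kan complex
`K` composition with `f` is a bijection `[B, K] → [A, K]` on simplicial homotopy classes. -/
def WeakEquiv {A B : SSet.{0}} (f : A ⟶ B) : Prop :=
  ∀ (K : SSet.{0}) [SSet.KanComplex K],
    (∀ g : A ⟶ K, ∃ h : B ⟶ K, Nonempty (SSet.Homotopy (f ≫ h) g)) ∧
    (∀ h h' : B ⟶ K, Nonempty (SSet.Homotopy (f ≫ h) (f ≫ h')) → Nonempty (SSet.Homotopy h h'))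

/-- A simplicial set is (weakly) contractible if the map to the point `Δ[0]` is a weak
homotopy equivalence. -/
def IsContractible (A : SSet.{0}) : Prop :=
  WeakEquiv (SSet.stdSimplex.isTerminalObj₀.from A)

lemma map_comp_yonedaEquiv_symm {K : SSet.{0}} {n m : SimplexCategoryᵒᵖ} (θ : n ⟶ m)
    (a : K.obj n) :
    SSet.stdSimplex.map θ.unop ≫ (SSet.yonedaEquiv.symm a : SSet.stdSimplex.obj n.unop ⟶ K) =
      SSet.yonedaEquiv.symm (K.map θ a) := by
  apply SSet.yonedaEquiv.injective
  rw [Equiv.apply_symm_apply]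
  change K.map (𝟙 _ ≫ θ.unop).op a = _
  rw [Category.id_comp]
  rfl

lemma stdSimplex_map_id (n : SimplexCategory) :
    SSet.stdSimplex.{0}.map (𝟙 n) = 𝟙 (SSet.stdSimplex.{0}.obj n) :=
  CategoryTheory.Functor.map_id (C := SimplexCategory) (D := SSet.{0}) SSet.stdSimplex n

lemma stdSimplex_map_comp {n m l : SimplexCategory} (f : n ⟶ m) (g : m ⟶ l) :
    SSet.stdSimplex.{0}.map (f ≫ g) = SSet.stdSimplex.map f ≫ SSet.stdSimplex.map g :=
  CategoryTheory.Functor.map_comp (C := SimplexCategory) (D := SSet.{0}) SSet.stdSimplex f g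

/-- Pointed simplicial sets. -/
structure PSSet where
  /-- the underlying simplicial set -/
  X : SSet.{0}
  /-- the base point -/
  pt : X _⦋0⦌

namespace PSSet

/-- Pointed maps. -/
@[ext]
structure Hom (A B : PSSet) where
  /-- the underlying map of simplicial sets -/
  map : A.X ⟶ B.X
  map_pt : map.app _ A.pt = B.pt

instance : Category PSSet where
  Hom := Hom
  id A := ⟨𝟙 _, rfl⟩
  comp f g := ⟨f.map ≫ g.map, by
    change g.map.app _ (f.map.app _ _) = _
    rw [f.map_pt, g.map_pt]⟩

@[ext]
lemma hom_ext {A B : PSSet} {f g : A ⟶ B} (h : f.map = g.map) : f = g := Hom.ext h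

@[simp] lemma id_map (A : PSSet) : Hom.map (𝟙 A) = 𝟙 A.X := rfl

@[simp] lemma comp_map {A B C : PSSet} (f : A ⟶ B) (g : B ⟶ C) :
    (f ≫ g).map = f.map ≫ g.map := rfl

lemma const_comp {A : SSet.{0}} {B C : PSSet} (f : B ⟶ C) :
    (SSet.const B.pt : A ⟶ B.X) ≫ f.map = SSet.const C.pt := by
  rw [SSet.const_comp, f.map_pt]

/-- The functor forgetting base points. -/
@[simps]
def forget : PSSet ⥤ SSet.{0} where
  obj A := A.X
  map f := f.map

/-- The underlying simplicial set of the loop object `Ω B`: an `n`-simplex is a map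
`Δ[n] × Δ[1] ⟶ B` that sends `Δ[n] × ∂Δ[1]` to the base point, that is, a pointed map
`Δ[n]₊ ∧ S¹ ⟶ B` with `S¹ = Δ[1]/∂Δ[1]`. -/
def loopSSet (B : PSSet) : SSet.{0} where
  obj n := { φ : SSet.stdSimplex.obj n.unop ⊗ Δ[1] ⟶ B.X //
    SSet.ι₀ ≫ φ = SSet.const B.pt ∧ SSet.ι₁ ≫ φ = SSet.const B.pt }
  map θ := ↾fun φ ↦ ⟨(SSet.stdSimplex.map θ.unop ▷ Δ[1]) ≫ φ.1, by
    rw [SSet.ι₀_comp_assoc, SSet.ι₁_comp_assoc, φ.2.1, φ.2.2]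
    exact ⟨rfl, rfl⟩⟩
  map_id n := by
    refine ConcreteCategory.hom_ext _ _ fun φ ↦ Subtype.ext ?_
    change (SSet.stdSimplex.map (𝟙 n.unop) ▷ Δ[1]) ≫ φ.1 = φ.1
    rw [stdSimplex_map_id, id_whiskerRight, Category.id_comp]
  map_comp θ θ' := by
    refine ConcreteCategory.hom_ext _ _ fun φ ↦ Subtype.ext ?_
    change (SSet.stdSimplex.map (θ'.unop ≫ θ.unop) ▷ Δ[1]) ≫ φ.1 =
      (SSet.stdSimplex.map θ'.unop ▷ Δ[1]) ≫ (SSet.stdSimplex.map θ.unop ▷ Δ[1]) ≫ φ.1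
    rw [stdSimplex_map_comp, comp_whiskerRight, Category.assoc]

/-- The loop object `Ω B`, pointed by the constant loop. -/
def loopObj (B : PSSet) : PSSet where
  X := B.loopSSet
  pt := ⟨SSet.const B.pt, rfl, rfl⟩

/-- The loop functor `Ω` on pointed simplicial sets. -/
def loop : PSSet ⥤ PSSet where
  obj := loopObj
  map {A B} f :=
    { map :=
        { app n := ↾fun φ ↦ ⟨φ.1 ≫ f.map, by
            rw [← Category.assoc, ← Category.assoc, φ.2.1, φ.2.2, const_comp]
            exact ⟨rfl, rfl⟩⟩
          naturality n m θ := by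
            ext φ
            apply Subtype.ext
            exact Category.assoc _ _ _ }
      map_pt := Subtype.ext (const_comp f) }
  map_id A := by
    apply PSSet.hom_ext
    ext n φ
    apply Subtype.ext
    exact Category.comp_id _
  map_comp f g := by
    apply PSSet.hom_ext
    ext n φ
    apply Subtype.ext
    exact (Category.assoc _ _ _).symm

/-- The iterated loop functor `Ωᵐ`, with `Ωᵐ⁺¹ B = Ωᵐ (Ω B)`. -/
def loopIter (m : ℕ) : PSSet ⥤ PSSet :=
  Nat.rec (motive := fun _ ↦ PSSet ⥤ PSSet) (𝟭 PSSet) (fun _ G ↦ loop ⋙ G) m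

/-- A pointed map `A ∧ S¹ ⟶ B` with `S¹ = Δ[1]/∂Δ[1]`, given as a map `A × Δ[1] ⟶ B` that sends
`A × ∂Δ[1]` and `pt × Δ[1]` to the base point. -/
@[ext]
structure SuspMap (A B : PSSet) where
  /-- the map `A × Δ[1] ⟶ B` -/
  map : A.X ⊗ Δ[1] ⟶ B.X
  map_zero : SSet.ι₀ ≫ map = SSet.const B.pt
  map_one : SSet.ι₁ ≫ map = SSet.const B.pt
  map_pt : CartesianMonoidalCategory.lift (SSet.const A.pt) (𝟙 Δ[1]) ≫ map = SSet.const B.pt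

/-- The adjoint `A ⟶ Ω B` of a pointed map `A ∧ S¹ ⟶ B`. -/
def SuspMap.adj {A B : PSSet} (σ : SuspMap A B) : A ⟶ loop.obj B where
  map :=
    { app n := ↾fun a ↦ ⟨(SSet.yonedaEquiv.symm a ▷ Δ[1]) ≫ σ.map, by
        rw [SSet.ι₀_comp_assoc, SSet.ι₁_comp_assoc, σ.map_zero, σ.map_one]
        exact ⟨rfl, rfl⟩⟩
      naturality n m θ := by
        ext a
        apply Subtype.ext
        change (SSet.yonedaEquiv.symm (A.X.map θ a) ▷ Δ[1]) ≫ σ.map =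
          (SSet.stdSimplex.map θ.unop ▷ Δ[1]) ≫ (SSet.yonedaEquiv.symm a ▷ Δ[1]) ≫ σ.map
        rw [← Category.assoc, ← comp_whiskerRight, map_comp_yonedaEquiv_symm] }
  map_pt := by
    apply Subtype.ext
    change (SSet.yonedaEquiv.symm A.pt ▷ Δ[1]) ≫ σ.map = SSet.const B.pt
    rw [SSet.yonedaEquiv_symm_zero]
    change CartesianMonoidalCategory.snd _ _ ≫
      CartesianMonoidalCategory.lift (SSet.const A.pt) (𝟙 Δ[1]) ≫ σ.map = _
    rw [σ.map_pt]
    rfl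

end PSSet

/-! ### Spectra -/

/-- A (Bousfield--Friedlander) spectrum: a sequence of pointed simplicial sets `X₀, X₁, …` with
pointed structure maps `Xₖ ∧ S¹ ⟶ Xₖ₊₁`. -/
structure Spectrum where
  /-- the levels -/
  level : ℕ → PSSet
  /-- the structure maps -/
  str (k : ℕ) : PSSet.SuspMap (level k) (level (k + 1))

namespace Spectrum

/-- Maps of spectra: levelwise pointed maps strictly compatible with the structure maps. -/
@[ext]
structure Hom (X Y : Spectrum) where
  /-- the levels -/
  f (k : ℕ) : X.level k ⟶ Y.level k
  comm (k : ℕ) : (X.str k).map ≫ (f (k + 1)).map = ((f k).map ▷ Δ[1]) ≫ (Y.str k).map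

instance : Category Spectrum where
  Hom := Hom
  id X := ⟨fun k ↦ 𝟙 _, fun k ↦ by simp⟩
  comp f g := ⟨fun k ↦ f.f k ≫ g.f k, fun k ↦ by
    simp only [PSSet.comp_map, comp_whiskerRight, Category.assoc, ← g.comm k]
    rw [← Category.assoc, f.comm k, Category.assoc]⟩

@[ext]
lemma hom_ext {X Y : Spectrum} {f g : X ⟶ Y} (h : ∀ k, f.f k = g.f k) : f = g :=
  Hom.ext (funext h)

/-- The `k`-th level of a spectrum, as a functor. -/
@[simps]
def levelFunctor (k : ℕ) : Spectrum ⥤ PSSet where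
  obj X := X.level k
  map f := f.f k

lemma adj_naturality {X Y : Spectrum} (f : X ⟶ Y) (k : ℕ) :
    (X.str k).adj ≫ PSSet.loop.map (f.f (k + 1)) = f.f k ≫ (Y.str k).adj := by
  apply PSSet.hom_ext
  ext n a
  apply Subtype.ext
  change (SSet.yonedaEquiv.symm a ▷ Δ[1] ≫ (X.str k).map) ≫ (f.f (k + 1)).map =
    SSet.yonedaEquiv.symm ((f.f k).map.app _ a) ▷ Δ[1] ≫ (Y.str k).map
  rw [Category.assoc, f.comm, ← SSet.yonedaEquiv_symm_comp, comp_whiskerRight, Category.assoc]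

/-- All levels are Kan complexes. -/
def IsLevelKan (X : Spectrum) : Prop := ∀ k, SSet.KanComplex (X.level k).X

/-- Levelwise weak homotopy equivalences. -/
def IsLevelEquiv {X Y : Spectrum} (f : X ⟶ Y) : Prop := ∀ k, WeakEquiv (f.f k).map

/-- Fibrant spectra (in the stable model structure): `Ω`-spectra all of whose levels are
Kan complexes. -/
def IsFibrant (X : Spectrum) : Prop :=
  X.IsLevelKan ∧ ∀ k, WeakEquiv (X.str k).adj.map

/-- The sequence `n ↦ π₀ Ωʲ⁺ⁿ Xᵢ₊ₙ`. -/
def piSeq (i j : ℕ) (X : Spectrum) : ℕ ⥤ Type :=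
  Functor.ofSequence (X := fun n ↦ SSet.π₀ ((PSSet.loopIter (j + n)).obj (X.level (i + n))).X)
    (fun n ↦ SSet.π₀Functor.map ((PSSet.loopIter (j + n)).map (X.str (i + n)).adj).map)

/-- The map of sequences `π₀ Ωʲ⁺ⁿ Xᵢ₊ₙ ⟶ π₀ Ωʲ⁺ⁿ Yᵢ₊ₙ` induced by a map of spectra. -/
def piSeqMap (i j : ℕ) {X Y : Spectrum} (f : X ⟶ Y) : piSeq i j X ⟶ piSeq i j Y :=
  NatTrans.ofSequence
    (fun n ↦ SSet.π₀Functor.map ((PSSet.loopIter (j + n)).map (f.f (i + n))).map)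
    (fun n ↦ by
      have h := congrArg (fun g ↦ SSet.π₀Functor.map ((PSSet.loopIter (j + n)).map g).map)
        (adj_naturality f (i + n))
      simp only [Functor.map_comp, PSSet.comp_map] at h
      refine Eq.trans (congrArg (· ≫ _) (Functor.ofSequence_map_homOfLE_succ _ n)) ?_
      refine Eq.trans ?_ (congrArg (_ ≫ ·) (Functor.ofSequence_map_homOfLE_succ _ n)).symm
      exact h)

/-- For a spectrum `X` whose levels are Kan complexes, the stable homotopy group
`π_{j-i} X = colimₙ π_{j+n} Xᵢ₊ₙ = colimₙ π₀ Ωʲ⁺ⁿ Xᵢ₊ₙ` (as a set). -/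
def stablePi (i j : ℕ) (X : Spectrum) : Type := Limits.colimit (piSeq i j X)

/-- The map induced by a map of spectra on the stable homotopy group `π_{j-i}`. -/
def stablePiMap (i j : ℕ) {X Y : Spectrum} (f : X ⟶ Y) : stablePi i j X → stablePi i j Y :=
  (Limits.colimMap (piSeqMap i j f) : _ ⟶ _)

/-- The stable equivalences of spectra: the maps that induce isomorphisms on all stable homotopy
groups `π_m`, `m ∈ ℤ`. The homotopy groups are computed after replacing the source and the target,
up to levelwise weak equivalence, by spectra whose levels are Kan complexes. -/
def IsStableEquiv {X Y : Spectrum} (f : X ⟶ Y) : Prop :=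
  ∃ (X' Y' : Spectrum) (a : X ⟶ X') (b : Y ⟶ Y') (f' : X' ⟶ Y'),
    a ≫ f' = f ≫ b ∧ IsLevelEquiv a ∧ IsLevelEquiv b ∧ X'.IsLevelKan ∧ Y'.IsLevelKan ∧
      ∀ i j : ℕ, Function.Bijective (stablePiMap i j f')

end Spectrum

/-! ### Homotopy limits -/

section Holim

variable {C D : Type} [SmallCategory C] [SmallCategory D]

/-- The diagram of simplicial sets `c ↦ N(C/c)`. -/
def overNerve (C : Type) [SmallCategory C] : C ⥤ SSet.{0} := Over.mapFunctor C ⋙ nerveFunctor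

/-- The diagram of simplicial sets `c ↦ Δ[n] × N(C/c)`. -/
abbrev simplexOverNerve (C : Type) [SmallCategory C] (n : SimplexCategory) : C ⥤ SSet.{0} :=
  overNerve C ⋙ tensorLeft (SSet.stdSimplex.obj n)

/-- The map of diagrams `Δ[n] × N(C/·) ⟶ Δ[m] × N(C/·)` induced by `[n] ⟶ [m]`. -/
abbrev simplexOverNerveMap (C : Type) [SmallCategory C] {n m : SimplexCategory} (θ : n ⟶ m) :
    simplexOverNerve C n ⟶ simplexOverNerve C m :=
  Functor.whiskerLeft (overNerve C) ((tensoringLeft SSet.{0}).map (SSet.stdSimplex.map θ))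

/-- The constant map of diagrams to the base points. -/
def constPt (X : C ⥤ PSSet) (W : C ⥤ SSet.{0}) : W ⟶ X ⋙ PSSet.forget where
  app c := SSet.const (X.obj c).pt
  naturality _ _ g := (PSSet.const_comp (X.map g)).symm

/-- The Bousfield--Kan homotopy limit of a diagram `X` of pointed simplicial sets: the space of
natural maps from the diagram `c ↦ N(C/c)` to `X`. An `n`-simplex is a natural family of maps
`Δ[n] × N(C/c) ⟶ X(c)`; the base point is the constant family. -/
def holimPSSet (X : C ⥤ PSSet) : PSSet where
  X :=
    { obj n := simplexOverNerve C n.unop ⟶ X ⋙ PSSet.forget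
      map θ := ↾fun α ↦ simplexOverNerveMap C θ.unop ≫ α
      map_id n := by
        refine ConcreteCategory.hom_ext _ _ fun α ↦ ?_
        change simplexOverNerveMap C (𝟙 n.unop) ≫ α = α
        rw [simplexOverNerveMap, stdSimplex_map_id, CategoryTheory.Functor.map_id]
        exact Category.id_comp _
      map_comp θ θ' := by
        refine ConcreteCategory.hom_ext _ _ fun α ↦ ?_
        change simplexOverNerveMap C (θ'.unop ≫ θ.unop) ≫ α =
          simplexOverNerveMap C θ'.unop ≫ simplexOverNerveMap C θ.unop ≫ α
        rw [simplexOverNerveMap, stdSimplex_map_comp, CategoryTheory.Functor.map_comp, Functor.whiskerLeft_comp]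
        exact Category.assoc _ _ _ }
  pt := constPt X _

/-- The map of diagrams `N(D/d) ⟶ N(C/F(d))`, `d ∈ D`, induced by a functor `F : D ⥤ C`. -/
def overNerveMap (F : D ⥤ C) : overNerve D ⟶ F ⋙ overNerve C where
  app d := nerveMap (Over.post F)
  naturality d e g := by
    have h : Over.map g ⋙ Over.post F = Over.post F ⋙ Over.map (F.map g) := by
      have hobj (k : Over d) : (Over.map g ⋙ Over.post F).obj k =
          (Over.post F ⋙ Over.map (F.map g)).obj k := congrArg Over.mk (F.map_comp k.hom g)
      have hleft {c : C} {A B : Over c} (hAB : A = B) :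
          (eqToHom hAB).left = eqToHom (congrArg (fun Z : Over c ↦ Z.left) hAB) := by
        subst hAB
        rfl
      refine CategoryTheory.Functor.ext hobj (fun k l u ↦ Over.OverMorphism.ext ?_)
      refine Eq.trans ?_ (congrArg₂ (fun p q ↦ p ≫ F.map u.left ≫ q)
        (hleft (hobj k)) (hleft (hobj l).symm)).symm
      exact ((Category.id_comp _).trans (Category.comp_id _)).symm
    exact congrArg nerveMap h

/-- The structure maps `holim Xₖ ∧ S¹ ⟶ holim Xₖ₊₁` of the homotopy limit of a diagram of spectra:
`(α, t)` is sent to the family `(u, y) ↦ σ_c (α_c (u, y), t (u))`. -/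
def holimStr (X : C ⥤ Spectrum) (k : ℕ) :
    PSSet.SuspMap (holimPSSet (X ⋙ Spectrum.levelFunctor k))
      (holimPSSet (X ⋙ Spectrum.levelFunctor (k + 1))) where
  map :=
    { app n := ↾fun p ↦
        { app c := CartesianMonoidalCategory.lift (p.1.app c)
              (CartesianMonoidalCategory.fst _ _ ≫ SSet.yonedaEquiv.symm p.2) ≫
            ((X.obj c).str k).map
          naturality c d g := by
            have h := p.1.naturality g
            have h' := (X.map g).comm k
            change _ = (CartesianMonoidalCategory.lift (p.1.app c)
              (CartesianMonoidalCategory.fst _ _ ≫ SSet.yonedaEquiv.symm p.2) ≫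
                ((X.obj c).str k).map) ≫ ((X.map g).f (k + 1)).map
            refine Eq.trans ?_ (congrArg (CartesianMonoidalCategory.lift (p.1.app c)
              (CartesianMonoidalCategory.fst _ _ ≫ SSet.yonedaEquiv.symm p.2) ≫ ·) h').symm
            have h2 : CartesianMonoidalCategory.lift
                ((simplexOverNerve C n.unop).map g ≫ p.1.app d)
                (CartesianMonoidalCategory.fst _ _ ≫ SSet.yonedaEquiv.symm p.2) =
              CartesianMonoidalCategory.lift (p.1.app c)
                (CartesianMonoidalCategory.fst _ _ ≫ SSet.yonedaEquiv.symm p.2) ≫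
                ((X.map g).f k).map ▷ Δ[1] := by
              rw [h]
              rfl
            exact congrArg (· ≫ ((X.obj d).str k).map) h2 }
      naturality n m θ := by
        refine ConcreteCategory.hom_ext _ _ fun p ↦ NatTrans.ext (funext fun c ↦ ?_)
        change CartesianMonoidalCategory.lift ((simplexOverNerveMap C θ.unop).app c ≫ p.1.app c)
            (CartesianMonoidalCategory.fst _ _ ≫ SSet.yonedaEquiv.symm (Δ[1].map θ p.2)) ≫ _ =
          (simplexOverNerveMap C θ.unop).app c ≫ CartesianMonoidalCategory.lift (p.1.app c)
            (CartesianMonoidalCategory.fst _ _ ≫ SSet.yonedaEquiv.symm p.2) ≫ _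
        rw [← map_comp_yonedaEquiv_symm]
        rfl }
  map_zero := by
    ext n α
    refine NatTrans.ext (funext fun c ↦ ?_)
    exact congrArg (α.app c ≫ ·) ((X.obj c).str k).map_zero
  map_one := by
    ext n α
    refine NatTrans.ext (funext fun c ↦ ?_)
    exact congrArg (α.app c ≫ ·) ((X.obj c).str k).map_one
  map_pt := by
    ext n t
    refine NatTrans.ext (funext fun c ↦ ?_)
    exact congrArg ((CartesianMonoidalCategory.fst _ _ ≫ SSet.yonedaEquiv.symm t) ≫ ·)
      ((X.obj c).str k).map_pt

/-- The homotopy limit of a diagram of spectra, formed levelwise. It is the homotopically correct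
one for diagrams of fibrant spectra. -/
def holim (X : C ⥤ Spectrum) : Spectrum where
  level k := holimPSSet (X ⋙ Spectrum.levelFunctor k)
  str k := holimStr X k

/-- The canonical map `F^* : holim_C X ⟶ holim_D (X ∘ F)` for a functor `F : D ⥤ C`: restriction
along `F` and along the maps `N(D/d) ⟶ N(C/F(d))`. -/
def holimRestrict (F : D ⥤ C) (X : C ⥤ Spectrum) : holim X ⟶ holim (F ⋙ X) where
  f k :=
    { map :=
        { app n := ↾fun α ↦
            Functor.whiskerRight (overNerveMap F) (tensorLeft (SSet.stdSimplex.obj n.unop)) ≫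
              Functor.whiskerLeft F α
          naturality n m θ := by
            ext α
            rfl }
      map_pt := by
        rfl }
  comm k := by
    rfl

/-- `r : X ⟶ X'` replaces each vertex of the diagram of spectra `X` by a fibrant spectrum:
`X'` is a diagram of fibrant spectra and `r` is a natural stable equivalence. -/
def IsFibrantReplacement {X X' : C ⥤ Spectrum} (r : X ⟶ X') : Prop :=
  ∀ c, (X'.obj c).IsFibrant ∧ Spectrum.IsStableEquiv (r.app c)

/-- A functor `F : D ⥤ C` is left cofinal if for each object `c` of `C` the left fiber `F/c`
(with objects `(d, F(d) ⟶ c)`) has contractible nerve. -/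
def IsLeftCofinal (F : D ⥤ C) : Prop :=
  ∀ c : C, IsContractible (nerve (CostructuredArrow F c))

end Holim

/-! ### The categories `P`, `Pⁿ`, `Δ`, `Δ^{<n}` and the functors `f`, `fⁿ` -/

/-- The partially ordered set of nonempty finite subsets of `S`. -/
abbrev FinSub (S : Set ℕ) : Type := { T : Finset ℕ // T.Nonempty ∧ (T : Set ℕ) ⊆ S }

/-- `P`: the nonempty finite subsets of `{1, 2, 3, …}`, ordered by inclusion. -/
abbrev P : Type := FinSub (Set.Ici 1)

/-- `Pⁿ`: the nonempty subsets of `{1, …, n}`, ordered by inclusion. -/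
abbrev Pn (n : ℕ) : Type := FinSub (Set.Icc 1 n)

lemma FinSub.card_eq {S : Set ℕ} (T : FinSub S) : T.1.card = (T.1.card - 1) + 1 :=
  (Nat.succ_pred_eq_of_pos (Finset.card_pos.2 T.2.1)).symm

/-- For `T = {t₀ < ⋯ < t_q}`, the order isomorphism `{0 < ⋯ < q} ≃ T`, `i ↦ tᵢ`. -/
def FinSub.enum {S : Set ℕ} (T : FinSub S) : Fin ((T.1.card - 1) + 1) ≃o T.1 :=
  T.1.orderIsoOfFin T.card_eq

/-- The functor that sends `T = {t₀ < ⋯ < t_q}` to `[q]`, `q = |T| - 1`, and an inclusion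
`T ⊆ T'` to the corresponding injective order-preserving map. -/
def toSimplex (S : Set ℕ) : FinSub S ⥤ SimplexCategory where
  obj T := SimplexCategory.mk (T.1.card - 1)
  map {T T'} g := SimplexCategory.mkHom
    { toFun i := T'.enum.symm ⟨(T.enum i).1, leOfHom g (T.enum i).2⟩
      monotone' i j hij := T'.enum.symm.monotone (T.enum.monotone hij) }
  map_id T := by
    ext i : 3
    exact T.enum.symm_apply_apply i
  map_comp {T T' T''} g h := by
    ext i : 3
    change T''.enum.symm _ = T''.enum.symm ⟨(T'.enum (T'.enum.symm _)).1, _⟩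
    simp

/-- The functor `f : P ⥤ Δ`. -/
def toDelta : P ⥤ SimplexCategory := toSimplex _

/-- `Δ^{<n}`: the full subcategory of `Δ` on the objects `[q]` with `q < n`. -/
abbrev DeltaLT (n : ℕ) : Type :=
  ObjectProperty.FullSubcategory (fun q : SimplexCategory ↦ q.len < n)

/-- The functor `fⁿ : Pⁿ ⥤ Δ^{<n}`, the restriction of `f`. -/
def toDeltaLT (n : ℕ) : Pn n ⥤ DeltaLT n :=
  ObjectProperty.lift _ (toSimplex _) (fun T ↦ by
    have h := Finset.card_le_card (fun t ht ↦ Finset.mem_Icc.2 (T.2.2 ht) : T.1 ⊆ Finset.Icc 1 n)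
    have h' := T.card_eq
    rw [Nat.card_Icc] at h
    change T.1.card - 1 < n
    omega)

end

end CosimplicialDescent

open CosimplicialDescent

namespace CosimplicialDescent

noncomputable section

open Limits HomotopicalAlgebra SSet.modelCategoryQuillen MorphismProperty

/-! ### Kan complexes and fibrations of diagrams -/

/-! Cofinality. Let `S` be the set of positive integers or `{1, …, n}`. An object of the left fiber
over `[q]` is a finite nonempty `T ⊆ S` with a monotone map to `[q]`. It is determined by its graph,
a finite chain in `S × [q]` for the order that is strict in the first coordinate and weak in the
second. The fiber is therefore a retract, up to a natural transformation, of the poset of such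
chains (`graphFunctor`, `chainArrow`, `graphChain`). This poset is contractible. Self maps `f`, `g`
of `S × [q]` that are contiguous induce homotopic maps on it, through the zigzag `f(G) ⊆ f(G) ∪ g(G)
⊇ g(G)`. Row by row, the points `(t, a)` are first pushed to `t ≤ a + 1` and then onto the diagonal
`t = a + 1`; the projection to the diagonal is contiguous to the constant map at `(1, 0)`. For `S =
{1, …, n}` the diagonal fits because `q < n`.

Homotopy limits. Maps `A ⟶ holim X` are natural maps `A × N(C/·) ⟶ X`, so `π₀` of the homotopy limit
consists of natural maps `N(C/·) ⟶ X` up to natural homotopy. The diagram `N(F/·)` is the left Kan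
extension of `N(D/·)` along `F`, so restriction along `F` amounts to precomposition with `N(F/·) ⟶
N(C/·)`. Both of these diagrams are objectwise contractible when `F` is left cofinal. The diagrams
`N(C/·)` and `N(D/·)` are projectively cofibrant (`isCofibrantDiagram_overNerve`), and `N(F/·)` has
a projective anodyne map to an objectwise acyclic Kan diagram `Z`. A map `N(C/·) ⟶ Z` then provides
an inverse to restriction up to homotopy (`IsLeftCofinal.exists_homotopy_inverse`), for every
objectwise Kan `X`.

Loops commute with homotopy limits (`loopHolimIso`) and preserve Kan complexes, so bijectivity on
`π₀` gives bijectivity on each `π₀ Ωᵐ` (`IsLeftCofinal.isIso_loopIter`), hence on the colimits that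
define stable homotopy groups. -/

lemma kanComplex_of_hornFilling {K : SSet.{0}}
    (h : ∀ (n : ℕ) (i : Fin (n + 2)) (σ₀ : (Λ[n + 1, i] : SSet.{0}) ⟶ K),
      ∃ σ : Δ[n + 1] ⟶ K, Λ[n + 1, i].ι ≫ σ = σ₀) : SSet.KanComplex K := by
  refine (isFibrant_iff _).2 ⟨?_⟩
  rw [fibrations_eq]
  intro _ _ _ hf
  simp only [J, MorphismProperty.iSup_iff] at hf
  obtain ⟨n, ⟨i⟩⟩ := hf
  refine ⟨fun {t _} _ ↦ ?_⟩
  obtain ⟨φ, hφ⟩ := h _ _ t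
  exact ⟨⟨{ l := φ, fac_left := hφ, fac_right := by subsingleton }⟩⟩

section Diagrams

variable {C : Type} [SmallCategory C]

/-- The generating projective trivial cofibrations of diagrams of simplicial sets: the free
diagrams on the horn inclusions. -/
def diagramJ (C : Type) [SmallCategory C] : MorphismProperty (C ⥤ SSet.{0}) :=
  .ofHoms (fun (x : C × (Σ n : ℕ, Fin (n + 2))) ↦
    (evaluationLeftAdjoint SSet.{0} x.1).map Λ[x.2.1 + 1, x.2.2].ι)

attribute [local instance] Cardinal.fact_isRegular_aleph0
  Cardinal.orderBotAleph0OrdToType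

instance : MorphismProperty.IsSmall.{0} (diagramJ C) :=
  isSmall_ofHoms ..

instance : IsCardinalForSmallObjectArgument (diagramJ C) Cardinal.aleph0.{0} where
  preservesColimit {A B X Y} i hi f hf := by
    have : IsFinitelyPresentable.{0} A := by
      obtain ⟨c, n, i⟩ := hi
      exact (evaluationAdjunctionRight SSet.{0} c).isCardinalPresentable_leftAdjoint_obj _ _
    infer_instance

instance : HasSmallObjectArgument.{0} (diagramJ C) :=
  ⟨.aleph0, inferInstance, inferInstance, inferInstance⟩

/-- The free diagram at `c` is left adjoint to evaluation at `c`, so lifting against a free horn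
inclusion is horn lifting at `c`. -/
lemma diagramJ_rlp_iff {E B : C ⥤ SSet.{0}} (p : E ⟶ B) :
    (diagramJ C).rlp p ↔ ∀ c, Fibration (p.app c) := by
  constructor
  · intro h c
    rw [SSet.modelCategoryQuillen.fibration_iff]
    intro _ _ _ hf
    simp only [J, MorphismProperty.iSup_iff] at hf
    obtain ⟨n, ⟨i⟩⟩ := hf
    exact ((evaluationAdjunctionRight SSet.{0} c).hasLiftingProperty_iff _ p).1
      (h _ (ofHoms.mk (ι := C × (Σ n : ℕ, Fin (n + 2))) (c, ⟨n, i⟩)))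
  · rintro h _ _ _ ⟨c, n, i⟩
    have := h c
    exact ((evaluationAdjunctionRight SSet.{0} c).hasLiftingProperty_iff _ p).2
      (inferInstanceAs (HasLiftingProperty Λ[n + 1, i].ι (p.app c)))

/-- A map of diagrams with the left lifting property against all objectwise Kan fibrations. -/
def IsDiagramAnodyne {A B : C ⥤ SSet.{0}} (j : A ⟶ B) : Prop :=
  ∀ ⦃E B' : C ⥤ SSet.{0}⦄ (p : E ⟶ B'), (∀ c, Fibration (p.app c)) → HasLiftingProperty j p

/-- The small object argument for `diagramJ` factors `W ⟶ *`; the second factor is an objectwise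
fibration. -/
lemma exists_fibrant_replacement (W : C ⥤ SSet.{0}) :
    ∃ (Z : C ⥤ SSet.{0}) (j : W ⟶ Z), IsDiagramAnodyne j ∧ ∀ c, SSet.KanComplex (Z.obj c) := by
  let d := MorphismProperty.factorizationData (diagramJ C).rlp.llp (diagramJ C).rlp
    (terminal.from W)
  refine ⟨d.Z, d.i, fun E B' p hp ↦ d.hi p ((diagramJ_rlp_iff p).2 hp), fun c ↦ ?_⟩
  have h := (diagramJ_rlp_iff _).1 d.hp c
  apply kanComplex_of_hornFilling
  intro n i σ₀
  have t : IsTerminal ((⊤_ (C ⥤ SSet.{0})).obj c) :=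
    IsTerminal.isTerminalObj ((evaluation C SSet.{0}).obj c) _ terminalIsTerminal
  have sq : CommSq σ₀ Λ[n + 1, i].ι (d.p.app c) (t.from _) := ⟨t.hom_ext _ _⟩
  exact ⟨sq.lift, sq.fac_left⟩

/-- Evaluation at `c` also has a right adjoint, whose value at `c'` is a product indexed by `c' ⟶
c`. Products of fibrations are fibrations, so the right adjoint preserves fibrations objectwise. -/
lemma IsDiagramAnodyne.app {A B : C ⥤ SSet.{0}} {j : A ⟶ B} (hj : IsDiagramAnodyne j) (c : C) :
    SSet.anodyneExtensions (j.app c) := by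
  intro E' B' p hp
  refine ((evaluationAdjunctionLeft SSet.{0} c).hasLiftingProperty_iff j p).2 (hj _ fun c' ↦ ?_)
  rw [SSet.modelCategoryQuillen.fibration_iff]
  have h : (Limits.Pi.lift fun g : c' ⟶ c ↦ Pi.π (fun _ : c' ⟶ c ↦ E') g ≫ p) =
      Limits.Pi.map (fun _ : c' ⟶ c ↦ p) := by
    refine Limits.Pi.hom_ext _ _ fun g ↦ ?_
    rw [Limits.Pi.map_π, Limits.Pi.lift_π]
  change J.rlp (Limits.Pi.lift fun g : c' ⟶ c ↦ Pi.π (fun _ : c' ⟶ c ↦ E') g ≫ p)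
  rw [h]
  exact MorphismProperty.limMap (W := J.rlp) _ fun _ ↦ hp

end Diagrams

end

end CosimplicialDescent

/-! ### Function complexes, natural homotopies and cofibrant diagrams -/

namespace CosimplicialDescent

noncomputable section

open Limits HomotopicalAlgebra SSet.modelCategoryQuillen MorphismProperty

/-! ### Lifting against restriction maps of function complexes -/

/-- By adjunction, lifting `∂Δ[n] ⟶ Δ[n]` against `X^Y ⟶ X^A` means extending a map from `A × Δ[n] ∪
Y × ∂Δ[n]` to `Y × Δ[n]`. -/
lemma rlp_I_pre {Y : SSet.{0}} (A : Y.Subcomplex) (X : SSet.{0})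
    (h : ∀ n : ℕ, HasLiftingProperty (A.unionProd ∂Δ[n]).ι (terminal.from X)) :
    I.rlp ((MonoidalClosed.pre A.ι).app X) := by
  suffices h' : ∀ n : ℕ, HasLiftingProperty ∂Δ[n].ι ((MonoidalClosed.pre A.ι).app X) by
    rintro _ _ _ ⟨n⟩
    exact h' n
  intro n
  exact (MonoidalClosed.internalHomAdjunction₂.hasLiftingProperty_iff
    (SSet.Subcomplex.unionProd.pushoutObjObj A ∂Δ[n])
    (Functor.PullbackObjObj.ofIsTerminal
      MonoidalClosed.internalHom A.ι (terminal.from X) terminalIsTerminal)).1 (h n)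

lemma rlp_I_pre_of_anodyne {Y : SSet.{0}} (A : Y.Subcomplex) (hA : SSet.anodyneExtensions A.ι)
    (X : SSet.{0}) [hX : SSet.KanComplex X] : I.rlp ((MonoidalClosed.pre A.ι).app X) :=
  rlp_I_pre A X fun n ↦ SSet.anodyneExtensions_unionProd_ι' A ∂Δ[n] hA _
    ((isFibrant_iff X).1 hX).mem

/-- A simplicial set with the extension property for all monomorphisms. -/
def IsAcyclicKan (Z : SSet.{0}) : Prop :=
  ∀ ⦃A B : SSet.{0}⦄ (i : A ⟶ B) [Mono i] (f : A ⟶ Z), ∃ g : B ⟶ Z, i ≫ g = f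

lemma IsAcyclicKan.rlp_I {Z : SSet.{0}} (hZ : IsAcyclicKan Z) {T : SSet.{0}} (hT : IsTerminal T) :
    I.rlp (hT.from Z) := by
  rintro _ _ _ ⟨n⟩
  refine ⟨fun {f _} _ ↦ ?_⟩
  obtain ⟨g, hg⟩ := hZ ∂Δ[n].ι f
  exact ⟨⟨{ l := g, fac_left := hg, fac_right := hT.hom_ext _ _ }⟩⟩

lemma IsAcyclicKan.rlp_I_pre {Z : SSet.{0}} (hZ : IsAcyclicKan Z) {Y : SSet.{0}}
    (A : Y.Subcomplex) : I.rlp ((MonoidalClosed.pre A.ι).app Z) := by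
  refine CosimplicialDescent.rlp_I_pre A Z fun n ↦ ?_
  have h := hZ.rlp_I terminalIsTerminal
  rw [← SSet.rlp_monomorphisms] at h
  exact h _ (inferInstanceAs (Mono (A.unionProd ∂Δ[n]).ι))

/-! ### Homotopies parametrized by `Δ[1] × A` -/

lemma asOrderHom_boundary_one {m : SimplexCategoryᵒᵖ} (s : (∂Δ[1] : SSet.{0}).obj m)
    (i j : Fin (m.unop.len + 1)) :
    SSet.stdSimplex.asOrderHom s.1 i = SSet.stdSimplex.asOrderHom s.1 j := by
  by_contra h
  refine s.2 fun y ↦ ?_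
  by_cases hy : SSet.stdSimplex.asOrderHom s.1 i = y
  · exact ⟨i, hy⟩
  · exact ⟨j, by omega⟩

/-- The map `∂Δ[1] × A ⟶ X` given by two maps `A ⟶ X`. -/
def boundaryPair {A X : SSet.{0}} (f g : A ⟶ X) : (∂Δ[1] : SSet.{0}) ⊗ A ⟶ X where
  app m := ↾fun x ↦ if SSet.stdSimplex.asOrderHom x.1.1 0 = 0 then f.app m x.2 else g.app m x.2
  naturality m m' θ := by
    ext x
    have h : SSet.stdSimplex.asOrderHom (Δ[1].map θ x.1.1) 0 =
        SSet.stdSimplex.asOrderHom x.1.1 0 := asOrderHom_boundary_one x.1 _ _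
    change (if SSet.stdSimplex.asOrderHom (Δ[1].map θ x.1.1) 0 = 0 then
        f.app m' (A.map θ x.2) else g.app m' (A.map θ x.2)) =
      X.map θ (if SSet.stdSimplex.asOrderHom x.1.1 0 = 0 then f.app m x.2 else g.app m x.2)
    rw [h]
    split_ifs
    · exact NatTrans.naturality_apply f θ x.2
    · exact NatTrans.naturality_apply g θ x.2

/-- The map `H : Δ[1] × A ⟶ X` is a homotopy from `f` to `g`. -/
def HasEnds {A X : SSet.{0}} (H : Δ[1] ⊗ A ⟶ X) (f g : A ⟶ X) : Prop :=
  (∀ m (a : A.obj m), H.app m (SSet.stdSimplex.const 1 0 m, a) = f.app m a) ∧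
    ∀ m (a : A.obj m), H.app m (SSet.stdSimplex.const 1 1 m, a) = g.app m a

/-- Rewrites the end conditions as a restriction to `∂Δ[1] × A`, the form in which they enter
lifting problems. -/
lemma hasEnds_iff {A X : SSet.{0}} (H : Δ[1] ⊗ A ⟶ X) (f g : A ⟶ X) :
    HasEnds H f g ↔ ∂Δ[1].ι ▷ A ≫ H = boundaryPair f g := by
  constructor
  · rintro ⟨h₀, h₁⟩
    ext m ⟨s, a⟩
    change H.app m (s.1, a) =
      if SSet.stdSimplex.asOrderHom s.1 0 = 0 then f.app m a else g.app m a
    have key (k : Fin 2) (hk : SSet.stdSimplex.asOrderHom s.1 0 = k) :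
        s.1 = SSet.stdSimplex.const 1 k m := by
      apply SSet.stdSimplex.objEquiv.injective
      ext i : 3
      exact (asOrderHom_boundary_one s i 0).trans hk
    split_ifs with h
    · rw [key 0 h, h₀]
    · rw [key 1 (Fin.eq_one_of_ne_zero _ h), h₁]
  · intro h
    have mem (k : Fin 2) (m : SimplexCategoryᵒᵖ) :
        SSet.stdSimplex.const 1 k m ∈ (∂Δ[1] : Δ[1].Subcomplex).obj m := by
      intro hs
      obtain ⟨i, hi⟩ := hs 0
      obtain ⟨j, hj⟩ := hs 1
      have hi : k = 0 := hi
      have hj : k = 1 := hj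
      omega
    have key (k : Fin 2) (m : SimplexCategoryᵒᵖ) (a : A.obj m) :
        H.app m (SSet.stdSimplex.const 1 k m, a) = if k = 0 then f.app m a else g.app m a :=
      congrArg (fun φ : (∂Δ[1] : SSet.{0}) ⊗ A ⟶ X ↦ φ.app m (⟨_, mem k m⟩, a)) h
    exact ⟨fun m a ↦ by simpa using key 0 m a, fun m a ↦ by simpa using key 1 m a⟩

section Diagrams

variable {C : Type} [SmallCategory C]

/-- Currying for diagrams of simplicial sets. -/
def curryDiagram {K : SSet.{0}} {A X : C ⥤ SSet.{0}} (H : A ⋙ tensorLeft K ⟶ X) :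
    A ⟶ X ⋙ ihom K where
  app c := MonoidalClosed.curry (H.app c)
  naturality c d g := by
    refine (MonoidalClosed.curry_natural_left _ _).symm.trans ?_
    refine Eq.trans ?_ (MonoidalClosed.curry_natural_right _ _)
    exact congrArg MonoidalClosed.curry (H.naturality g)

/-- Uncurrying for diagrams of simplicial sets. -/
def uncurryDiagram {K : SSet.{0}} {A X : C ⥤ SSet.{0}} (H : A ⟶ X ⋙ ihom K) :
    A ⋙ tensorLeft K ⟶ X where
  app c := MonoidalClosed.uncurry (H.app c)
  naturality c d g := by
    refine (MonoidalClosed.uncurry_natural_left _ _).symm.trans ?_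
    refine Eq.trans ?_ (MonoidalClosed.uncurry_natural_right _ _)
    exact congrArg MonoidalClosed.uncurry (H.naturality g)

/-- The restriction map of function complexes, for a diagram. -/
def preDiagram {K L : SSet.{0}} (i : K ⟶ L) (X : C ⥤ SSet.{0}) : X ⋙ ihom L ⟶ X ⋙ ihom K :=
  Functor.whiskerLeft X (MonoidalClosed.pre i)

/-- After currying, the two prescribed restrictions form a square from `j` to `X^L ⟶ X^K`. -/
lemma exists_tensor_lift {K L : SSet.{0}} (i : K ⟶ L) {A A' : C ⥤ SSet.{0}} (j : A ⟶ A')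
    (X : C ⥤ SSet.{0}) (hj : HasLiftingProperty j (preDiagram i X))
    (a : A ⋙ tensorLeft L ⟶ X) (b : A' ⋙ tensorLeft K ⟶ X)
    (h : ∀ c, i ▷ A.obj c ≫ a.app c = K ◁ j.app c ≫ b.app c) :
    ∃ l : A' ⋙ tensorLeft L ⟶ X, (∀ c, L ◁ j.app c ≫ l.app c = a.app c) ∧
      ∀ c, i ▷ A'.obj c ≫ l.app c = b.app c := by
  have sq : CommSq (curryDiagram a) j (preDiagram i X) (curryDiagram b) := ⟨by
    ext c : 2
    exact (MonoidalClosed.curry_pre_app _ _).trans ((congrArg MonoidalClosed.curry (h c)).trans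
      (MonoidalClosed.curry_natural_left _ _))⟩
  refine ⟨uncurryDiagram sq.lift, fun c ↦ ?_, fun c ↦ ?_⟩
  · refine (MonoidalClosed.uncurry_natural_left _ _).symm.trans ?_
    refine (congrArg MonoidalClosed.uncurry (congr_app sq.fac_left c)).trans ?_
    exact MonoidalClosed.uncurry_curry _
  · refine (MonoidalClosed.uncurry_pre_app _ _ i).symm.trans ?_
    refine (congrArg MonoidalClosed.uncurry (congr_app sq.fac_right c)).trans ?_
    exact MonoidalClosed.uncurry_curry _

/-- A diagram of simplicial sets with the lifting property against all objectwise trivial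
fibrations. -/
def IsCofibrantDiagram (A : C ⥤ SSet.{0}) : Prop :=
  ∀ ⦃E B : C ⥤ SSet.{0}⦄ (p : E ⟶ B), (∀ c, I.rlp (p.app c)) →
    ∀ b : A ⟶ B, ∃ l : A ⟶ E, l ≫ p = b

lemma IsCofibrantDiagram.exists_tensor_lift {A : C ⥤ SSet.{0}} (hA : IsCofibrantDiagram A)
    {K L : SSet.{0}} (i : K ⟶ L) (X : C ⥤ SSet.{0})
    (hi : ∀ c, I.rlp ((MonoidalClosed.pre i).app (X.obj c))) (b : A ⋙ tensorLeft K ⟶ X) :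
    ∃ l : A ⋙ tensorLeft L ⟶ X, ∀ c, i ▷ A.obj c ≫ l.app c = b.app c := by
  obtain ⟨l, hl⟩ := hA (preDiagram i X) hi (curryDiagram b)
  refine ⟨uncurryDiagram l, fun c ↦ ?_⟩
  refine (MonoidalClosed.uncurry_pre_app _ _ i).symm.trans ?_
  refine (congrArg MonoidalClosed.uncurry (congr_app hl c)).trans ?_
  exact MonoidalClosed.uncurry_curry _

/-- Two maps of diagrams are joined by a natural homotopy. -/
def DiagramHomotopic {A X : C ⥤ SSet.{0}} (f g : A ⟶ X) : Prop :=
  ∃ H : A ⋙ tensorLeft Δ[1] ⟶ X, ∀ c, HasEnds (H.app c) (f.app c) (g.app c)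

lemma DiagramHomotopic.precomp {A A' X : C ⥤ SSet.{0}} {f g : A ⟶ X}
    (h : DiagramHomotopic f g) (k : A' ⟶ A) : DiagramHomotopic (k ≫ f) (k ≫ g) := by
  obtain ⟨H, hH⟩ := h
  exact ⟨Functor.whiskerRight k _ ≫ H, fun c ↦
    ⟨fun m a ↦ (hH c).1 m ((k.app c).app m a), fun m a ↦ (hH c).2 m ((k.app c).app m a)⟩⟩

lemma DiagramHomotopic.postcomp {A X X' : C ⥤ SSet.{0}} {f g : A ⟶ X}
    (h : DiagramHomotopic f g) (k : X ⟶ X') : DiagramHomotopic (f ≫ k) (g ≫ k) := by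
  obtain ⟨H, hH⟩ := h
  exact ⟨H ≫ k, fun c ↦
    ⟨fun m a ↦ congrArg ((k.app c).app m) ((hH c).1 m a),
      fun m a ↦ congrArg ((k.app c).app m) ((hH c).2 m a)⟩⟩

/-- The objectwise `boundaryPair`. -/
def boundaryPairDiagram {A X : C ⥤ SSet.{0}} (f g : A ⟶ X) :
    A ⋙ tensorLeft (∂Δ[1] : SSet.{0}) ⟶ X where
  app c := boundaryPair (f.app c) (g.app c)
  naturality c d k := by
    ext m ⟨s, a⟩
    change (if SSet.stdSimplex.asOrderHom s.1 0 = 0 then (f.app d).app m ((A.map k).app m a) else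
        (g.app d).app m ((A.map k).app m a)) =
      (X.map k).app m (if SSet.stdSimplex.asOrderHom s.1 0 = 0 then (f.app c).app m a else
        (g.app c).app m a)
    split_ifs
    · exact ConcreteCategory.congr_hom (congr_app (f.naturality k) m) a
    · exact ConcreteCategory.congr_hom (congr_app (g.naturality k) m) a

/-- A natural homotopy defined on `A` extends along a projective anodyne map `A ⟶ A'`, with
prescribed ends. -/
lemma IsDiagramAnodyne.diagramHomotopic {A A' X : C ⥤ SSet.{0}} {j : A ⟶ A'}
    (hj : IsDiagramAnodyne j) (hX : ∀ c, SSet.KanComplex (X.obj c)) {f g : A' ⟶ X}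
    (h : DiagramHomotopic (j ≫ f) (j ≫ g)) : DiagramHomotopic f g := by
  obtain ⟨H, hH⟩ := h
  -- Sending a path to its end points, `X^Δ[1] ⟶ X^∂Δ[1]`, is an objectwise fibration, so `j` lifts
  -- against it.
  obtain ⟨l, -, hl⟩ := exists_tensor_lift ∂Δ[1].ι j X (hj _ fun c ↦ by
    have := hX c
    exact inferInstanceAs (Fibration ((MonoidalClosed.pre ∂Δ[1].ι).app (X.obj c)))) H
    (boundaryPairDiagram f g) (fun c ↦ (hasEnds_iff _ _ _).1 (hH c))
  exact ⟨l, fun c ↦ (hasEnds_iff _ _ _).2 (hl c)⟩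

lemma IsDiagramAnodyne.exists_extension {A A' X : C ⥤ SSet.{0}} {j : A ⟶ A'}
    (hj : IsDiagramAnodyne j) (hX : ∀ c, SSet.KanComplex (X.obj c)) (f : A ⟶ X) :
    ∃ g : A' ⟶ X, j ≫ g = f := by
  have := hj (terminal.from X) fun c ↦ by
    have := hX c
    exact (isFibrant_iff_of_isTerminal _ (IsTerminal.isTerminalObj ((evaluation C SSet.{0}).obj c) _
      terminalIsTerminal)).1 this
  have sq : CommSq f j (terminal.from X) (terminal.from A') := ⟨by simp⟩
  exact ⟨sq.lift, sq.fac_left⟩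

/-- Maps from a cofibrant diagram to an objectwise acyclic one exist. -/
lemma IsCofibrantDiagram.nonempty_hom {A Z : C ⥤ SSet.{0}} (hA : IsCofibrantDiagram A)
    (hZ : ∀ c, IsAcyclicKan (Z.obj c)) : Nonempty (A ⟶ Z) := by
  obtain ⟨l, -⟩ := hA (terminal.from Z) (fun c ↦ by
    have t : IsTerminal ((⊤_ (C ⥤ SSet.{0})).obj c) :=
      IsTerminal.isTerminalObj ((evaluation C SSet.{0}).obj c) _ terminalIsTerminal
    have h := (hZ c).rlp_I t
    rwa [t.hom_ext (t.from _) ((terminal.from Z).app c)] at h)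
    (terminal.from A)
  exact ⟨l⟩

/-- Maps from a cofibrant diagram to an objectwise acyclic one are homotopic. -/
lemma IsCofibrantDiagram.diagramHomotopic {A Z : C ⥤ SSet.{0}} (hA : IsCofibrantDiagram A)
    (hZ : ∀ c, IsAcyclicKan (Z.obj c)) (f g : A ⟶ Z) : DiagramHomotopic f g := by
  obtain ⟨l, hl⟩ := hA.exists_tensor_lift ∂Δ[1].ι Z (fun c ↦ (hZ c).rlp_I_pre _)
    (boundaryPairDiagram f g)
  exact ⟨l, fun c ↦ (hasEnds_iff _ _ _).2 (hl c)⟩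

end Diagrams

end

end CosimplicialDescent

namespace CosimplicialDescent

noncomputable section

open Limits HomotopicalAlgebra SSet.modelCategoryQuillen MorphismProperty

/-! ### Contractible Kan complexes -/

lemma exists_tensor_lift_sset {K L A A' X : SSet.{0}} (i : K ⟶ L) (j : A ⟶ A')
    (hj : HasLiftingProperty j ((MonoidalClosed.pre i).app X))
    (a : L ⊗ A ⟶ X) (b : K ⊗ A' ⟶ X) (h : i ▷ A ≫ a = K ◁ j ≫ b) :
    ∃ l : L ⊗ A' ⟶ X, L ◁ j ≫ l = a ∧ i ▷ A' ≫ l = b := by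
  have sq : CommSq (MonoidalClosed.curry a) j ((MonoidalClosed.pre i).app X)
      (MonoidalClosed.curry b) := ⟨
    (MonoidalClosed.curry_pre_app _ _).trans ((congrArg MonoidalClosed.curry h).trans
      (MonoidalClosed.curry_natural_left _ _))⟩
  refine ⟨MonoidalClosed.uncurry sq.lift, ?_, ?_⟩
  · rw [← MonoidalClosed.uncurry_natural_left, sq.fac_left, MonoidalClosed.uncurry_curry]
  · rw [← MonoidalClosed.uncurry_pre_app, sq.fac_right, MonoidalClosed.uncurry_curry]

/-- The end of a homotopy. -/
def homotopyEnd (A : SSet.{0}) (k : Fin 2) : A ⟶ Δ[1] ⊗ A :=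
  CartesianMonoidalCategory.lift (SSet.const (SSet.stdSimplex.obj₀Equiv.symm k)) (𝟙 A)

lemma horn_one_zero_eq {m : SimplexCategoryᵒᵖ} (s : (Λ[1, 0] : SSet.{0}).obj m) :
    s.1 = SSet.stdSimplex.const 1 0 m := by
  have hs := (SSet.mem_horn_iff 0 s.1).1 s.2
  apply SSet.stdSimplex.objEquiv.injective
  ext i : 3
  by_contra hi
  refine hs (Set.eq_univ_of_forall fun y ↦ ?_)
  by_cases hy : y = 0
  · exact Or.inr hy
  · refine Or.inl ⟨i, ?_⟩
    rw [Fin.eq_one_of_ne_zero y hy]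
    exact Fin.eq_one_of_ne_zero _ hi

/-- Contractibility of `W` makes `j` homotopic to a constant map; extended along the anodyne `j`,
this contracts `Z`. Every map `A ⟶ Z` is then homotopic to a constant map, which extends over `B`,
and homotopy extension finishes. -/
lemma IsContractible.isAcyclicKan {W Z : SSet.{0}} (hW : IsContractible W) {j : W ⟶ Z}
    (hj : SSet.anodyneExtensions j) [hZ : SSet.KanComplex Z] : IsAcyclicKan Z := by
  obtain ⟨h, ⟨H⟩⟩ := (hW Z).1 j
  -- The extended homotopy is given the ends "constant" and "identity of `Z`".
  obtain ⟨G, -, hG⟩ := exists_tensor_lift_sset ∂Δ[1].ι j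
    (hj _ ((SSet.modelCategoryQuillen.fibration_iff _).1 inferInstance))
    ((β_ _ _).hom ≫ H.h) (boundaryPair (SSet.stdSimplex.isTerminalObj₀.from Z ≫ h) (𝟙 Z))
    ((hasEnds_iff _ (SSet.stdSimplex.isTerminalObj₀.from W ≫ h) j).1
      ⟨fun m a ↦ congrArg (fun φ : W ⟶ Z ↦ φ.app m a) H.h₀,
        fun m a ↦ congrArg (fun φ : W ⟶ Z ↦ φ.app m a) H.h₁⟩)
  replace hG := (hasEnds_iff _ _ _).2 hG
  intro A B i hi f
  -- `Λ[1, 0]` is the vertex `0`, so this trivial fibration is evaluation of paths at their start.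
  -- Lifting `i` against it extends a homotopy from `A` to `B` with a prescribed start.
  have hr := rlp_I_pre_of_anodyne (Λ[1, 0] : Δ[1].Subcomplex) (SSet.anodyneExtensions.horn_ι 0) Z
  rw [← SSet.rlp_monomorphisms] at hr
  obtain ⟨l, hl, -⟩ := exists_tensor_lift_sset Λ[1, 0].ι i (hr i hi) (Δ[1] ◁ f ≫ G)
    (CartesianMonoidalCategory.snd _ _ ≫ SSet.stdSimplex.isTerminalObj₀.from B ≫ h) (by
      ext m ⟨s, a⟩
      change G.app m (s.1, f.app m a) = h.app m _
      rw [horn_one_zero_eq s, hG.1]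
      exact congrArg (fun φ : A ⟶ Δ[0] ↦ h.app m (φ.app m a))
        (SSet.stdSimplex.isTerminalObj₀.hom_ext (f ≫ SSet.stdSimplex.isTerminalObj₀.from Z)
          (i ≫ SSet.stdSimplex.isTerminalObj₀.from B)))
  refine ⟨homotopyEnd B 1 ≫ l, ?_⟩
  ext m a
  exact (congrArg (fun φ : Δ[1] ⊗ A ⟶ Z ↦ φ.app m (SSet.stdSimplex.const 1 1 m, a)) hl).trans
    (hG.2 m (f.app m a))

/-- Existence of an extension up to homotopy is the hypothesis. For uniqueness, a homotopy on `A` is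
restricted to the vertex `a`, a section of `A ⟶ Δ[0]`. -/
lemma isContractible_of_nullHomotopic {A : SSet.{0}} (a : A _⦋0⦌)
    (h : ∀ (K : SSet.{0}) [SSet.KanComplex K] (g : A ⟶ K),
      ∃ x : K _⦋0⦌, Nonempty (SSet.Homotopy (SSet.const x) g)) : IsContractible A := by
  intro K _
  refine ⟨fun g ↦ ?_, fun f g ⟨H⟩ ↦ ?_⟩
  · obtain ⟨x, hx⟩ := h K g
    exact ⟨SSet.const x, hx⟩
  · let s : Δ[0] ⟶ A := SSet.yonedaEquiv.symm a
    have hs : s ≫ SSet.stdSimplex.isTerminalObj₀.from A = 𝟙 _ :=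
      SSet.stdSimplex.isTerminalObj₀.hom_ext _ _
    have hc (k : Δ[0] ⟶ K) : s ≫ SSet.stdSimplex.isTerminalObj₀.from A ≫ k = k := by
      rw [← Category.assoc, hs, Category.id_comp]
    exact ⟨
      { h := s ▷ Δ[1] ≫ H.h
        h₀ := by
          rw [SSet.ι₀_comp_assoc, H.h₀, hc]
          rfl
        h₁ := by
          rw [SSet.ι₁_comp_assoc, H.h₁, hc]
          rfl
        rel := by
          ext m ⟨⟨x, hx⟩, _⟩
          exact hx.elim }⟩

end

end CosimplicialDescent

/-! ### Projective cofibrancy of `N(D/·)` -/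

namespace CosimplicialDescent

noncomputable section

open Limits HomotopicalAlgebra SSet.modelCategoryQuillen

/-! ### Chains in comma categories -/

section Chains

variable {C D : Type} [SmallCategory C] [SmallCategory D]

lemma costructuredArrow_obj_ext {F : D ⥤ C} {c : C} {X Y : CostructuredArrow F c}
    (h : X.left = Y.left) (h' : X.hom = F.map (eqToHom h) ≫ Y.hom) : X = Y := by
  obtain ⟨X, ⟨⟨⟩⟩, f⟩ := X
  obtain ⟨Y, ⟨⟨⟩⟩, g⟩ := Y
  obtain rfl : X = Y := h
  obtain rfl : f = g := by simpa using h'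
  rfl

lemma costructuredArrow_chain_ext {F : D ⥤ C} {c : C} {k : ℕ}
    {x y : ComposableArrows (CostructuredArrow F c) k}
    (h : x ⋙ CostructuredArrow.proj F c = y ⋙ CostructuredArrow.proj F c)
    (h' : ∀ i, (x.obj i).hom = F.map (eqToHom (Functor.congr_obj h i)) ≫ (y.obj i).hom) :
    x = y := by
  have hobj (i : Fin (k + 1)) : x.obj i = y.obj i :=
    costructuredArrow_obj_ext (Functor.congr_obj h i) (h' i)
  refine CategoryTheory.Functor.ext hobj fun i j f ↦ CommaMorphism.ext ?_ (by subsingleton)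
  rw [Comma.comp_left, Comma.comp_left, Comma.eqToHom_left, Comma.eqToHom_left]
  exact Functor.congr_hom h f

/-- The tautological lift of a chain in `D` to the comma category over its last object. -/
def tautChain (F : D ⥤ C) {k : ℕ} (σ : ComposableArrows D k) :
    ComposableArrows (CostructuredArrow F (F.obj (σ.obj (Fin.last k)))) k where
  obj i := CostructuredArrow.mk (F.map (σ.map (homOfLE (Fin.le_last i))))
  map f := CostructuredArrow.homMk (σ.map f) (by
    simp only [CostructuredArrow.mk_left, CostructuredArrow.mk_hom_eq_self, ← Functor.map_comp]
    rfl)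
  map_id i := by
    ext
    exact σ.map_id i
  map_comp f g := by
    ext
    exact σ.map_comp f g

/-- A face may drop the last object. The restricted chain is then tautological over its new last
object, pushed forward along the arrow to the old one. -/
lemma map_tautChain (F : D ⥤ C) {n m : SimplexCategoryᵒᵖ} (η : n ⟶ m) (σ : (nerve D).obj n) :
    (nerve (CostructuredArrow F (F.obj (σ.obj (Fin.last _))))).map η (tautChain F σ) =
      (nerveMap (CostructuredArrow.map (F.map (σ.map (homOfLE (Fin.le_last
        (η.unop.toOrderHom (Fin.last _)))))))).app m (tautChain F ((nerve D).map η σ)) := by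
  refine costructuredArrow_chain_ext rfl fun i ↦ ?_
  refine Eq.trans ?_ (Eq.symm ((congrArg (· ≫ _) (F.map_id _)).trans (Category.id_comp _)))
  refine Eq.trans ?_ (F.map_comp _ _)
  exact congrArg F.map (σ.map_comp _ _)

/-- Tautological chains generate: every chain in a comma category is one of them, pushed along the
structure map of its last object. -/
lemma map_tautChain_proj (F : D ⥤ C) {c : C} {n : SimplexCategoryᵒᵖ}
    (x : (nerve (CostructuredArrow F c)).obj n) :
    (nerveMap (CostructuredArrow.map (x.obj (Fin.last _)).hom)).app n
      (tautChain F ((nerveMap (CostructuredArrow.proj F c)).app n x)) = x := by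
  refine costructuredArrow_chain_ext rfl fun i ↦ ?_
  refine Eq.trans ?_ (Eq.symm ((congrArg (· ≫ _) (F.map_id _)).trans (Category.id_comp _)))
  exact CostructuredArrow.w (x.map (homOfLE (Fin.le_last i)))

end Chains

/-! ### The diagram of nerves of over categories is cofibrant -/

section Cofibrant

variable {D : Type} [SmallCategory D] {E B : D ⥤ SSet.{0}} (p : E ⟶ B) (b : overNerve D ⟶ B)

/-- The simplex of the base determined by a chain. -/
abbrev baseSimplex {n : SimplexCategoryᵒᵖ} (σ : (nerve D).obj n) :
    (B.obj (σ.obj (Fin.last _))).obj n :=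
  (b.app (σ.obj (Fin.last _))).app n (tautChain (𝟭 D) σ)

lemma map_baseSimplex {n m : SimplexCategoryᵒᵖ} (η : n ⟶ m) (σ : (nerve D).obj n) :
    (B.map (σ.map (homOfLE (Fin.le_last (η.unop.toOrderHom (Fin.last _)))))).app m
      (baseSimplex b ((nerve D).map η σ)) = (B.obj _).map η (baseSimplex b σ) := by
  refine Eq.trans ?_ (NatTrans.naturality_apply (b.app _) η (tautChain (𝟭 D) σ))
  refine Eq.trans ?_ (congrArg ((b.app _).app m) (map_tautChain (𝟭 D) η σ).symm)
  exact (ConcreteCategory.congr_hom (congr_app (b.naturality _) m) _).symm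

/-- A compatible family of simplices of `E` over the faces and degeneracies of a chain. -/
@[ext]
structure ChainLift {n : SimplexCategoryᵒᵖ} (σ : (nerve D).obj n) where
  /-- the simplices -/
  simplex (m : SimplexCategory) (θ : m ⟶ n.unop) :
    (E.obj (σ.obj (θ.toOrderHom (Fin.last _)))).obj (op m)
  compat {l m : SimplexCategory} (η : l ⟶ m) (θ : m ⟶ n.unop) :
    (E.map (σ.map (homOfLE (θ.toOrderHom.monotone
      (Fin.le_last (η.toOrderHom (Fin.last _))))))).app (op l) (simplex l (η ≫ θ)) =
        (E.obj _).map η.op (simplex m θ)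
  lies_over (m : SimplexCategory) (θ : m ⟶ n.unop) :
    (p.app _).app _ (simplex m θ) = baseSimplex b ((nerve D).map θ.op σ)

variable {p b} in
lemma ChainLift.simplex_heq {n : SimplexCategoryᵒᵖ} {σ : (nerve D).obj n} (L : ChainLift p b σ)
    {m : SimplexCategory} {θ θ' : m ⟶ n.unop} (h : θ = θ') :
    L.simplex m θ ≍ L.simplex m θ' := by
  rw [h]

/-- The simplicial set of chains in `D` together with a lift. -/
def chainLifts : SSet.{0} where
  obj n := Σ σ : (nerve D).obj n, ChainLift p b σ
  map ξ := ↾fun t ↦ ⟨(nerve D).map ξ t.1,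
    { simplex m θ := t.2.simplex m (θ ≫ ξ.unop)
      compat η θ := t.2.compat η (θ ≫ ξ.unop)
      lies_over m θ := t.2.lies_over m (θ ≫ ξ.unop) }⟩
  map_id n := ConcreteCategory.hom_ext _ _ fun t ↦ by
    refine Sigma.ext rfl (heq_of_eq (ChainLift.ext (funext₂ fun m θ ↦ eq_of_heq ?_)))
    exact t.2.simplex_heq (θ := θ ≫ 𝟙 _) (θ' := θ) (Category.comp_id θ)
  map_comp ξ ξ' := ConcreteCategory.hom_ext _ _ fun _ ↦ rfl

/-- The projection that forgets the lift. -/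
def chainLiftsProj : chainLifts p b ⟶ nerve D where
  app n := ↾fun t ↦ t.1

variable {p b}

/-- The top simplex of a lift of the chain `ρ`. -/
def topSimplex {n : SimplexCategoryᵒᵖ} (t : (chainLifts p b).obj n) (ρ : (nerve D).obj n)
    (h : t.1 = ρ) : (E.obj (ρ.obj (Fin.last _))).obj n :=
  (E.map (eqToHom (Functor.congr_obj h _))).app n (t.2.simplex n.unop (𝟙 _))

lemma topSimplex_self {n : SimplexCategoryᵒᵖ} (t : (chainLifts p b).obj n) :
    topSimplex t t.1 rfl = t.2.simplex n.unop (𝟙 _) :=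
  congrArg (fun φ : E.obj _ ⟶ E.obj _ ↦ φ.app n (t.2.simplex n.unop (𝟙 _))) (E.map_id _)

lemma topSimplex_map_eq {n : SimplexCategoryᵒᵖ} (t : (chainLifts p b).obj n) (m : SimplexCategory)
    (θ : m ⟶ n.unop) : topSimplex ((chainLifts p b).map θ.op t) ((nerve D).map θ.op t.1) rfl =
      t.2.simplex m θ :=
  (topSimplex_self ((chainLifts p b).map θ.op t)).trans
    (eq_of_heq (t.2.simplex_heq (θ := 𝟙 m ≫ θ) (θ' := θ) (Category.id_comp θ)))

lemma map_topSimplex {n m : SimplexCategoryᵒᵖ} (η : n ⟶ m) (t : (chainLifts p b).obj n)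
    (ρ : (nerve D).obj n) (h : t.1 = ρ)
    (h' : ((chainLifts p b).map η t).1 = (nerve D).map η ρ) :
    (E.map (ρ.map (homOfLE (Fin.le_last (η.unop.toOrderHom (Fin.last _)))))).app m
      (topSimplex ((chainLifts p b).map η t) ((nerve D).map η ρ) h') =
        (E.obj _).map η (topSimplex t ρ h) := by
  subst h
  rw [topSimplex_self t]
  refine Eq.trans ?_ (t.2.compat η.unop (𝟙 _))
  refine congrArg ((E.map _).app m) ((topSimplex_self ((chainLifts p b).map η t)).trans ?_)
  exact eq_of_heq (t.2.simplex_heq ((Category.id_comp _).trans (Category.comp_id _).symm))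

lemma topSimplex_over {n : SimplexCategoryᵒᵖ} (t : (chainLifts p b).obj n) (ρ : (nerve D).obj n)
    (h : t.1 = ρ) : (p.app _).app n (topSimplex t ρ h) = baseSimplex b ρ := by
  subst h
  rw [topSimplex_self t]
  exact t.2.lies_over _ (𝟙 _)

/-- The underlying chains are only propositionally equal; comparing top simplices confines the
transport to an `eqToHom`. -/
lemma chainLifts_ext {n : SimplexCategoryᵒᵖ} {t t' : (chainLifts p b).obj n} (h : t.1 = t'.1)
    (h' : ∀ (m : SimplexCategory) (θ : m ⟶ n.unop),
      topSimplex ((chainLifts p b).map θ.op t) ((nerve D).map θ.op t'.1)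
        (congrArg ((nerve D).map θ.op) h) = t'.2.simplex m θ) : t = t' := by
  obtain ⟨σ, L⟩ := t
  obtain ⟨σ', L'⟩ := t'
  obtain rfl : σ = σ' := h
  congr 1
  ext m θ
  exact (topSimplex_map_eq (p := p) (b := b) ⟨σ, L⟩ m θ).symm.trans (h' m θ)

lemma map_map_chain (A : D ⥤ SSet.{0}) {k : ℕ} (σ : ComposableArrows D k) {i j l : Fin (k + 1)}
    (hij : i ≤ j) (hjl : j ≤ l) {m : SimplexCategoryᵒᵖ} (x : (A.obj (σ.obj i)).obj m) :
    (A.map (σ.map (homOfLE hjl))).app m ((A.map (σ.map (homOfLE hij))).app m x) =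
      (A.map (σ.map (homOfLE (hij.trans hjl)))).app m x := by
  have h : σ.map (homOfLE (hij.trans hjl)) =
      σ.map (homOfLE hij) ≫ σ.map (homOfLE hjl) := σ.map_comp (homOfLE hij) (homOfLE hjl)
  rw [h, A.map_comp]
  rfl

lemma map_chain_self (A : D ⥤ SSet.{0}) {k : ℕ} (σ : ComposableArrows D k) {i : Fin (k + 1)}
    {m : SimplexCategoryᵒᵖ} (x : (A.obj (σ.obj i)).obj m) :
    (A.map (σ.map (homOfLE (le_refl i)))).app m x = x := by
  have h : σ.map (homOfLE (le_refl i)) = 𝟙 _ := σ.map_id i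
  rw [h, A.map_id]
  rfl

section Boundary

variable {n : ℕ} (f : (∂Δ[n] : SSet.{0}) ⟶ chainLifts p b) (σ : ComposableArrows D n)
  (hf : ∀ (m : SimplexCategoryᵒᵖ) (s : (∂Δ[n] : SSet.{0}).obj m),
    (f.app m s).1 = (nerve D).map (X := op ⦋n⦌) (SSet.stdSimplex.objEquiv s.1).op σ)

/-- The simplex over a proper face prescribed by a map from the boundary. -/
def boundarySimplex {m : SimplexCategoryᵒᵖ} (s : (∂Δ[n] : SSet.{0}).obj m) :
    (E.obj (σ.obj ((SSet.stdSimplex.objEquiv s.1).toOrderHom (Fin.last _)))).obj m :=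
  topSimplex (f.app m s) _ (hf m s)

lemma boundarySimplex_over {m : SimplexCategoryᵒᵖ} (s : (∂Δ[n] : SSet.{0}).obj m) :
    (p.app _).app m (boundarySimplex f σ hf s) = baseSimplex b
      ((nerve D).map (X := op ⦋n⦌) (SSet.stdSimplex.objEquiv s.1).op σ) :=
  topSimplex_over _ _ (hf m s)

lemma map_boundarySimplex {m l : SimplexCategoryᵒᵖ} (η : m ⟶ l)
    (s : (∂Δ[n] : SSet.{0}).obj m) :
    (E.map (σ.map (homOfLE ((SSet.stdSimplex.objEquiv s.1).toOrderHom.monotone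
      (Fin.le_last (η.unop.toOrderHom (Fin.last _))))))).app l
        (boundarySimplex f σ hf ((∂Δ[n] : SSet.{0}).map η s)) =
      (E.obj _).map η (boundarySimplex f σ hf s) := by
  have h := NatTrans.naturality_apply f η s
  have h' := map_topSimplex η (f.app m s) _ (hf m s) (by
    rw [← h]
    exact hf l _)
  refine Eq.trans ?_ h'
  refine congrArg ((E.map _).app l) ?_
  unfold boundarySimplex
  congr 1

/-- The induced map from the boundary to the value at the last object. -/
def boundaryToLast : (∂Δ[n] : SSet.{0}) ⟶ E.obj (σ.obj (Fin.last n)) where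
  app m := ↾fun s ↦ (E.map (σ.map (homOfLE (Fin.le_last _)))).app m (boundarySimplex f σ hf s)
  naturality m l η := by
    ext s
    change (E.map (σ.map _)).app l (boundarySimplex f σ hf ((∂Δ[n] : SSet.{0}).map η s)) =
      (E.obj _).map η ((E.map (σ.map _)).app m (boundarySimplex f σ hf s))
    refine Eq.trans ?_ (NatTrans.naturality_apply (E.map (σ.map _)) η _)
    rw [← map_boundarySimplex f σ hf η s]
    exact (map_map_chain E σ _ _ _).symm

end Boundary

/-- Given lifts on the boundary of a chain `σ`, everything is pushed to the value of `E` at the last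
object of `σ`. There a single lifting problem against the trivial fibration `p` produces the missing
top simplex. -/
lemma chainLiftsProj_rlp (hp : ∀ d, I.rlp (p.app d)) : I.rlp (chainLiftsProj p b) := by
  suffices h : ∀ n : ℕ, HasLiftingProperty ∂Δ[n].ι (chainLiftsProj p b) by
    rintro _ _ _ ⟨n⟩
    exact h n
  refine fun n ↦ ⟨fun {f τ} sq ↦ ?_⟩
  let σ : ComposableArrows D n := SSet.yonedaEquiv τ
  have hτ (m : SimplexCategoryᵒᵖ) (s : Δ[n].obj m) :
      τ.app m s = (nerve D).map (X := op ⦋n⦌) (SSet.stdSimplex.objEquiv s).op σ :=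
    congrArg (fun φ : Δ[n] ⟶ nerve D ↦ φ.app m s) (SSet.yonedaEquiv.symm_apply_apply τ).symm
  have hf (m : SimplexCategoryᵒᵖ) (s : (∂Δ[n] : SSet.{0}).obj m) :
      (f.app m s).1 = (nerve D).map (X := op ⦋n⦌) (SSet.stdSimplex.objEquiv s.1).op σ :=
    (congrArg (fun φ : (∂Δ[n] : SSet.{0}) ⟶ nerve D ↦ φ.app m s) sq.w).trans (hτ m s.1)
  have sq' : CommSq (boundaryToLast f σ hf) ∂Δ[n].ι (p.app (σ.obj (Fin.last n)))
      (SSet.yonedaEquiv.symm (baseSimplex (n := op ⦋n⦌) b σ)) := ⟨by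
    ext m s
    refine (ConcreteCategory.congr_hom (congr_app (p.naturality (σ.map (homOfLE
      (Fin.le_last _)))) m) (boundarySimplex f σ hf s)).trans ?_
    refine (congrArg ((B.map _).app m) (boundarySimplex_over f σ hf s)).trans ?_
    exact map_baseSimplex (n := op ⦋n⦌) b (SSet.stdSimplex.objEquiv s.1).op σ⟩
  have := hp (σ.obj (Fin.last n)) _ (boundary_ι_mem_I n)
  let e := SSet.yonedaEquiv sq'.lift
  have he (m : SimplexCategoryᵒᵖ) (s : Δ[n].obj m) :
      sq'.lift.app m s = (E.obj _).map (SSet.stdSimplex.objEquiv s).op e :=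
    congrArg (fun φ : Δ[n] ⟶ _ ↦ φ.app m s) (SSet.yonedaEquiv.symm_apply_apply sq'.lift).symm
  have hpe : (p.app _).app _ e = baseSimplex (n := op ⦋n⦌) b σ := by
    have h := congrArg SSet.yonedaEquiv sq'.fac_right
    rwa [SSet.yonedaEquiv_comp, Equiv.apply_symm_apply] at h
  -- An operator outside the boundary is surjective, so it hits the last vertex and its simplex lies
  -- over the last object of `σ`.
  have hlast {m : SimplexCategory} (θ : m ⟶ ⦋n⦌)
      (hθ : SSet.stdSimplex.objEquiv.symm θ ∉ (∂Δ[n] : Δ[n].Subcomplex).obj (op m)) :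
      Fin.last n ≤ θ.toOrderHom (Fin.last _) := by
    obtain ⟨i, hi⟩ := (not_not.1 hθ) (Fin.last n)
    exact hi.symm.le.trans (θ.toOrderHom.monotone (Fin.le_last i))
  classical
  -- Boundary simplices are kept as given. The others are restrictions of `e`, carried along an
  -- arrow between equal indices of the chain.
  let S (m : SimplexCategory) (θ : m ⟶ ⦋n⦌) :
      (E.obj (σ.obj (θ.toOrderHom (Fin.last _)))).obj (op m) :=
    if hθ : SSet.stdSimplex.objEquiv.symm θ ∈ (∂Δ[n] : Δ[n].Subcomplex).obj (op m) then
      boundarySimplex f σ hf ⟨_, hθ⟩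
    else (E.map (σ.map (homOfLE (hlast θ hθ)))).app _ ((E.obj _).map θ.op e)
  have hS_mem {m : SimplexCategory} (θ : m ⟶ ⦋n⦌)
      (hθ : SSet.stdSimplex.objEquiv.symm θ ∈ (∂Δ[n] : Δ[n].Subcomplex).obj (op m)) :
      S m θ = boundarySimplex f σ hf ⟨_, hθ⟩ := dif_pos hθ
  have hS_notMem {m : SimplexCategory} (θ : m ⟶ ⦋n⦌)
      (hθ : SSet.stdSimplex.objEquiv.symm θ ∉ (∂Δ[n] : Δ[n].Subcomplex).obj (op m)) :
      S m θ = (E.map (σ.map (homOfLE (hlast θ hθ)))).app _ ((E.obj _).map θ.op e) := dif_neg hθ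
  -- After transport to the last object both cases become restrictions of `e`; this gives
  -- compatibility between a surjective operator and its faces.
  have hS_last {m : SimplexCategory} (θ : m ⟶ ⦋n⦌) :
      (E.map (σ.map (homOfLE (Fin.le_last (θ.toOrderHom (Fin.last _)))))).app _ (S m θ) =
        (E.obj _).map θ.op e := by
    by_cases hθ : SSet.stdSimplex.objEquiv.symm θ ∈ (∂Δ[n] : Δ[n].Subcomplex).obj (op m)
    · rw [hS_mem θ hθ]
      refine Eq.trans ?_ (he (op m) (SSet.stdSimplex.objEquiv.symm θ))
      exact (congrArg (fun φ : (∂Δ[n] : SSet.{0}) ⟶ _ ↦ φ.app (op m) ⟨_, hθ⟩)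
        sq'.fac_left).symm
    · rw [hS_notMem θ hθ, map_map_chain]
      exact map_chain_self E σ _
  let L : ChainLift p b (n := op ⦋n⦌) σ :=
    { simplex := S
      compat {l m} η θ := by
        by_cases hθ : SSet.stdSimplex.objEquiv.symm θ ∈ (∂Δ[n] : Δ[n].Subcomplex).obj (op m)
        · have hη : SSet.stdSimplex.objEquiv.symm (η ≫ θ) ∈
            (∂Δ[n] : Δ[n].Subcomplex).obj (op l) := (∂Δ[n] : Δ[n].Subcomplex).map η.op hθ
          rw [hS_mem θ hθ, hS_mem _ hη]
          exact map_boundarySimplex f σ hf η.op ⟨_, hθ⟩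
        · rw [hS_notMem θ hθ]
          refine Eq.trans ?_ (NatTrans.naturality_apply (E.map (σ.map _)) η.op _)
          refine Eq.trans ?_ (congrArg ((E.map _).app _) ((hS_last (η ≫ θ)).trans
            (Functor.map_comp_apply (E.obj _) θ.op η.op e)))
          exact (map_map_chain E σ _ _ _).symm
      lies_over m θ := by
        by_cases hθ : SSet.stdSimplex.objEquiv.symm θ ∈ (∂Δ[n] : Δ[n].Subcomplex).obj (op m)
        · rw [hS_mem θ hθ]
          exact boundarySimplex_over f σ hf ⟨_, hθ⟩
        · rw [hS_notMem θ hθ]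
          refine (ConcreteCategory.congr_hom (congr_app (p.naturality (σ.map (homOfLE
            (hlast θ hθ)))) (op m)) _).trans ?_
          refine (congrArg ((B.map _).app _) (NatTrans.naturality_apply (p.app _) θ.op e)).trans ?_
          rw [hpe, ← map_baseSimplex (n := op ⦋n⦌) b θ.op σ]
          refine (map_map_chain B σ _ _ _).trans ?_
          exact map_chain_self B σ _ }
  let t : (chainLifts p b).obj (op ⦋n⦌) := ⟨σ, L⟩
  refine ⟨⟨{ l := SSet.yonedaEquiv.symm t, fac_left := ?_, fac_right := ?_ }⟩⟩
  · ext m s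
    refine (chainLifts_ext (t' := (chainLifts p b).map (SSet.stdSimplex.objEquiv s.1).op t)
      (hf m s) fun l θ ↦ ?_).symm
    refine Eq.trans ?_ (hS_mem (θ ≫ SSet.stdSimplex.objEquiv s.1)
      ((∂Δ[n] : SSet.{0}).map θ.op s).2).symm
    have h := NatTrans.naturality_apply f θ.op s
    unfold boundarySimplex
    congr 1
    exact h.symm
  · apply SSet.yonedaEquiv.injective
    rw [SSet.yonedaEquiv_comp, Equiv.apply_symm_apply]
    rfl

variable (D) in
-- A section of `chainLiftsProj` chooses compatible lifts of the tautological chains, and pushing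
-- these along structure maps of last objects lifts `b` on all chains. The section exists because a
-- trivial fibration lifts against `∅ ⟶ N(D)`.
lemma isCofibrantDiagram_overNerve : IsCofibrantDiagram (overNerve D) := by
  intro E B p hp b
  have hr := chainLiftsProj_rlp (b := b) hp
  rw [← SSet.rlp_monomorphisms] at hr
  have := hr (⊥ : (nerve D).Subcomplex).ι inferInstance
  have sq : CommSq (SSet.Subcomplex.isInitialBot.to (chainLifts p b)) (⊥ : (nerve D).Subcomplex).ι
      (chainLiftsProj p b) (𝟙 (nerve D)) := ⟨SSet.Subcomplex.isInitialBot.hom_ext _ _⟩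
  have hs (m : SimplexCategoryᵒᵖ) (σ : (nerve D).obj m) : (sq.lift.app m σ).1 = σ :=
    congrArg (fun φ : nerve D ⟶ nerve D ↦ φ.app m σ) sq.fac_right
  let l (d : D) (m : SimplexCategoryᵒᵖ) (x : (nerve (Over d)).obj m) : (E.obj d).obj m :=
    (E.map (x.obj (Fin.last _)).hom).app m
      (topSimplex (sq.lift.app m _) ((nerveMap (CostructuredArrow.proj (𝟭 D) d)).app m x) (hs m _))
  have map_comp {d₀ d₁ d₂ : D} (u : d₀ ⟶ d₁) (v : d₁ ⟶ d₂) {m : SimplexCategoryᵒᵖ}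
      (y : (E.obj d₀).obj m) :
      (E.map (u ≫ v)).app m y = (E.map v).app m ((E.map u).app m y) := by
    rw [E.map_comp]
    rfl
  refine ⟨{ app d := { app m := ↾(l d m), naturality m m' η := ?_ }, naturality d d' g := ?_ }, ?_⟩
  · ext x
    let ρ : (nerve D).obj m := (nerveMap (CostructuredArrow.proj (𝟭 D) d)).app m x
    have hw : (x.obj (η.unop.toOrderHom (Fin.last _))).hom =
        ρ.map (homOfLE (Fin.le_last (η.unop.toOrderHom (Fin.last _)))) ≫
          (x.obj (Fin.last _)).hom := (Over.w (x.map (homOfLE (Fin.le_last _)))).symm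
    change (E.map (x.obj (η.unop.toOrderHom (Fin.last _))).hom).app m' _ =
      (E.obj d).map η ((E.map (x.obj (Fin.last _)).hom).app m _)
    rw [hw]
    refine (map_comp (ρ.map (homOfLE (Fin.le_last (η.unop.toOrderHom (Fin.last _)))))
      (x.obj (Fin.last _)).hom _).trans ?_
    refine Eq.trans ?_ (NatTrans.naturality_apply (E.map (x.obj (Fin.last _)).hom) η _)
    refine congrArg ((E.map _).app m') ?_
    have h := NatTrans.naturality_apply sq.lift η ρ
    refine Eq.trans ?_ (map_topSimplex η (sq.lift.app m ρ) ρ (hs m ρ) (by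
      rw [← h]
      exact hs m' _))
    refine congrArg ((E.map _).app m') ?_
    congr 1
  · ext m x
    exact map_comp (x.obj (Fin.last _)).hom g _
  · ext d m x
    let ρ : (nerve D).obj m := (nerveMap (CostructuredArrow.proj (𝟭 D) d)).app m x
    refine (ConcreteCategory.congr_hom (congr_app (p.naturality (x.obj (Fin.last _)).hom) m)
      (topSimplex (sq.lift.app m ρ) ρ (hs m ρ))).trans ?_
    refine (congrArg ((B.map (x.obj (Fin.last _)).hom).app m)
      (topSimplex_over (sq.lift.app m ρ) ρ (hs m ρ))).trans ?_
    refine (ConcreteCategory.congr_hom (congr_app (b.naturality (x.obj (Fin.last _)).hom) m)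
      (tautChain (𝟭 D) ρ)).symm.trans ?_
    exact congrArg ((b.app d).app m) (map_tautChain_proj (𝟭 D) x)

end Cofibrant

end

end CosimplicialDescent

/-! ### Homotopies between functors, and `N(F/·)` as a Kan extension -/

namespace CosimplicialDescent

noncomputable section

open Limits HomotopicalAlgebra SSet.modelCategoryQuillen

/-! ### Homotopy of maps into a Kan complex is an equivalence relation -/

lemma nonempty_homotopy_iff {A X : SSet.{0}} (f g : A ⟶ X) :
    Nonempty (SSet.Homotopy f g) ↔ ∃ H : Δ[1] ⊗ A ⟶ X, HasEnds H f g := by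
  constructor
  · rintro ⟨H⟩
    exact ⟨(β_ _ _).hom ≫ H.h, fun m a ↦ congrArg (fun φ : A ⟶ X ↦ φ.app m a) H.h₀,
      fun m a ↦ congrArg (fun φ : A ⟶ X ↦ φ.app m a) H.h₁⟩
  · rintro ⟨H, h₀, h₁⟩
    exact ⟨
      { h := (β_ _ _).hom ≫ H
        h₀ := by
          ext m a
          exact h₀ m a
        h₁ := by
          ext m a
          exact h₁ m a
        rel := by
          ext m ⟨⟨x, hx⟩, _⟩
          exact hx.elim }⟩

lemma hasEnds_refl {A X : SSet.{0}} (f : A ⟶ X) :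
    HasEnds (CartesianMonoidalCategory.snd _ _ ≫ f) f f :=
  ⟨fun _ _ ↦ rfl, fun _ _ ↦ rfl⟩

lemma mono_whiskerRight {A B : SSet.{0}} (i : A ⟶ B) [Mono i] (X : SSet.{0}) : Mono (i ▷ X) := by
  have (m : SimplexCategoryᵒᵖ) : Mono ((i ▷ X).app m) := by
    rw [CategoryTheory.mono_iff_injective]
    rintro ⟨a, x⟩ ⟨b, y⟩ h
    exact Prod.ext ((CategoryTheory.mono_iff_injective (i.app m)).1 inferInstance
      (Prod.mk.inj h).1) (Prod.mk.inj h).2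
  exact NatTrans.mono_of_mono_app _

/-- Together, `H` and `H'` are a homotopy on `∂Δ[1] × A` that starts at `f`. It extends to a
homotopy on `Δ[1] × A` that starts at the constant homotopy of `f`, and the end of the extension
joins `g` to `h`. -/
lemma HasEnds.exists_of_common_source {A X : SSet.{0}} [SSet.KanComplex X] {f g h : A ⟶ X}
    {H H' : Δ[1] ⊗ A ⟶ X} (hH : HasEnds H f g) (hH' : HasEnds H' f h) :
    ∃ H'' : Δ[1] ⊗ A ⟶ X, HasEnds H'' g h := by
  have hr := rlp_I_pre_of_anodyne (Λ[1, 0] : Δ[1].Subcomplex) (SSet.anodyneExtensions.horn_ι 0) X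
  rw [← SSet.rlp_monomorphisms] at hr
  obtain ⟨l, hl, -⟩ := exists_tensor_lift_sset Λ[1, 0].ι (∂Δ[1].ι ▷ A)
    (hr _ (mono_whiskerRight _ A))
    (CartesianMonoidalCategory.lift
      (CartesianMonoidalCategory.snd _ _ ≫ CartesianMonoidalCategory.fst _ _)
      (CartesianMonoidalCategory.lift (CartesianMonoidalCategory.fst _ _)
        (CartesianMonoidalCategory.snd _ _ ≫ CartesianMonoidalCategory.snd _ _)) ≫
      boundaryPair H H')
    (CartesianMonoidalCategory.snd _ _ ≫ CartesianMonoidalCategory.snd _ _ ≫ f) (by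
      ext m ⟨s, t, a⟩
      change (if SSet.stdSimplex.asOrderHom t.1 0 = 0 then H.app m (s.1, a) else
        H'.app m (s.1, a)) = f.app m a
      rw [horn_one_zero_eq s]
      split_ifs
      · exact hH.1 m a
      · exact hH'.1 m a)
  refine ⟨homotopyEnd (Δ[1] ⊗ A) 1 ≫ l, (hasEnds_iff _ _ _).2 ?_⟩
  ext m ⟨t, a⟩
  refine (congrArg (fun φ : Δ[1] ⊗ (∂Δ[1] : SSet.{0}) ⊗ A ⟶ X ↦
    φ.app m (SSet.stdSimplex.const 1 1 m, t, a)) hl).trans ?_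
  change (if SSet.stdSimplex.asOrderHom t.1 0 = 0 then
      H.app m (SSet.stdSimplex.const 1 1 m, a) else H'.app m (SSet.stdSimplex.const 1 1 m, a)) =
    if SSet.stdSimplex.asOrderHom t.1 0 = 0 then g.app m a else h.app m a
  rw [hH.2, hH'.2]

/-- Completing a pair with common source against the constant homotopy gives symmetry; reversing the
first homotopy then gives transitivity. -/
lemma homotopy_equivalence (A X : SSet.{0}) [SSet.KanComplex X] :
    Equivalence (fun f g : A ⟶ X ↦ Nonempty (SSet.Homotopy f g)) := by
  simp only [nonempty_homotopy_iff]
  have symm {f g : A ⟶ X} : (∃ H, HasEnds H f g) → ∃ H, HasEnds H g f :=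
    fun ⟨_, hH⟩ ↦ hH.exists_of_common_source (hasEnds_refl f)
  refine ⟨fun f ↦ ⟨_, hasEnds_refl f⟩, symm, fun h h' ↦ ?_⟩
  obtain ⟨_, h⟩ := symm h
  obtain ⟨_, h'⟩ := h'
  exact h.exists_of_common_source h'

/-! ### Nerves and natural transformations -/

section Nerve

variable {C D E : Type} [SmallCategory C] [SmallCategory D] [SmallCategory E]

/-- A simplex of `Δ[1]` as a chain in `Fin 2`. -/
def chainOfSimplex {m : SimplexCategoryᵒᵖ} (s : Δ[1].obj m) :
    ComposableArrows (Fin 2) m.unop.len :=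
  (SSet.stdSimplex.asOrderHom s).monotone.functor

/-- A natural transformation gives a simplicial homotopy between the maps of nerves. -/
lemma nonempty_homotopy_of_natTrans {F G : C ⥤ D} (α : F ⟶ G) :
    Nonempty (SSet.Homotopy (nerveMap F) (nerveMap G)) := by
  refine (nonempty_homotopy_iff _ _).2
    ⟨{ app m := ↾fun x ↦ (chainOfSimplex x.1).prod' x.2 ⋙
         Functor.uncurry.obj (ComposableArrows.mk₁ α)
       naturality m m' η := rfl }, fun m x ↦ ?_, fun m x ↦ ?_⟩
  · refine CategoryTheory.Functor.ext (fun i ↦ rfl) fun i j f ↦ ?_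
    change ((ComposableArrows.mk₁ α).map (𝟙 0)).app (x.obj i) ≫ F.map (x.map f) =
      𝟙 _ ≫ F.map (x.map f) ≫ 𝟙 _
    rw [(ComposableArrows.mk₁ α).map_id]
    exact (congrArg (𝟙 _ ≫ ·) (Category.comp_id _)).symm
  · refine CategoryTheory.Functor.ext (fun i ↦ rfl) fun i j f ↦ ?_
    change ((ComposableArrows.mk₁ α).map (𝟙 1)).app (x.obj i) ≫ G.map (x.map f) =
      𝟙 _ ≫ G.map (x.map f) ≫ 𝟙 _
    rw [(ComposableArrows.mk₁ α).map_id]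
    exact (congrArg (𝟙 _ ≫ ·) (Category.comp_id _)).symm

/-- Two functors become homotopic after mapping the nerve of the target to any Kan complex. -/
def NerveHomotopic (F G : C ⥤ D) : Prop :=
  ∀ (K : SSet.{0}) [SSet.KanComplex K] (k : nerve D ⟶ K),
    Nonempty (SSet.Homotopy (nerveMap F ≫ k) (nerveMap G ≫ k))

lemma nerveHomotopic_of_natTrans {F G : C ⥤ D} (α : F ⟶ G) : NerveHomotopic F G := by
  intro K _ k
  obtain ⟨H, hH⟩ := (nonempty_homotopy_iff _ _).1 (nonempty_homotopy_of_natTrans α)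
  exact (nonempty_homotopy_iff _ _).2 ⟨H ≫ k, fun m a ↦ congrArg (k.app m) (hH.1 m a),
    fun m a ↦ congrArg (k.app m) (hH.2 m a)⟩

lemma NerveHomotopic.symm {F G : C ⥤ D} (h : NerveHomotopic F G) : NerveHomotopic G F :=
  fun K _ k ↦ (homotopy_equivalence _ K).symm (h K k)

lemma NerveHomotopic.trans {F G H : C ⥤ D} (h : NerveHomotopic F G) (h' : NerveHomotopic G H) :
    NerveHomotopic F H :=
  fun K _ k ↦ (homotopy_equivalence _ K).trans (h K k) (h' K k)

lemma NerveHomotopic.comp_right {F G : C ⥤ D} (h : NerveHomotopic F G) (H : D ⥤ E) :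
    NerveHomotopic (F ⋙ H) (G ⋙ H) :=
  fun K _ k ↦ h K (nerveMap H ≫ k)

lemma NerveHomotopic.comp_left {F G : C ⥤ D} (h : NerveHomotopic F G) (H : E ⥤ C) :
    NerveHomotopic (H ⋙ F) (H ⋙ G) := by
  intro K _ k
  obtain ⟨T, hT⟩ := (nonempty_homotopy_iff _ _).1 (h K k)
  exact (nonempty_homotopy_iff _ _).2 ⟨Δ[1] ◁ nerveMap H ≫ T,
    fun m a ↦ hT.1 m ((nerveMap H).app m a), fun m a ↦ hT.2 m ((nerveMap H).app m a)⟩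

/-- The constant functor induces a constant map of nerves, so every map from the nerve to a Kan
complex is null-homotopic. -/
lemma isContractible_nerve {d : D} (h : NerveHomotopic (𝟭 D) ((Functor.const D).obj d)) :
    IsContractible (nerve D) := by
  refine isContractible_of_nullHomotopic (ComposableArrows.mk₀ d) fun K _ g ↦
    ⟨g.app _ (ComposableArrows.mk₀ d), ?_⟩
  have hg : nerveMap ((Functor.const D).obj d) ≫ g = SSet.const (g.app _ (ComposableArrows.mk₀ d)) := by
    have h' : nerveMap ((Functor.const D).obj d) =
        SSet.const (ComposableArrows.mk₀ d : (nerve D) _⦋0⦌) := by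
      ext m x
      refine CategoryTheory.Functor.ext (fun i ↦ rfl) fun i j f ↦ ?_
      exact ((Category.id_comp _).trans (Category.id_comp _)).symm
    exact (congrArg (· ≫ g) h').trans (SSet.const_comp _ _)
  exact hg ▸ h.symm K g

lemma isContractible_nerve_of_isTerminal {d : D} (hd : IsTerminal d) :
    IsContractible (nerve D) :=
  isContractible_nerve (nerveHomotopic_of_natTrans
    { app X := hd.from X, naturality _ _ _ := hd.hom_ext _ _ } (G := (Functor.const D).obj d))

/-- The identity of `C` is joined by `α` to `Φ ⋙ Ψ`, which factors through `D` and so is joined to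
the constant functor at `Ψ.obj d`. -/
lemma isContractible_nerve_of_retract (Φ : C ⥤ D) (Ψ : D ⥤ C) (α : Φ ⋙ Ψ ⟶ 𝟭 C) {d : D}
    (h : NerveHomotopic (𝟭 D) ((Functor.const D).obj d)) : IsContractible (nerve C) :=
  isContractible_nerve (d := Ψ.obj d)
    (((nerveHomotopic_of_natTrans α).symm.trans ((h.comp_left Φ).comp_right Ψ)).trans
      (nerveHomotopic_of_natTrans { app _ := 𝟙 (Ψ.obj d) }))

end Nerve

/-! ### The diagram of nerves of left fibers -/

section CostructuredNerve

variable {C D : Type} [SmallCategory C] [SmallCategory D] (F : D ⥤ C)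

/-- The diagram of simplicial sets `c ↦ N(F/c)`. -/
def costructuredNerve : C ⥤ SSet.{0} where
  obj c := nerve (CostructuredArrow F c)
  map g := nerveMap (CostructuredArrow.map g)
  map_id c := by
    ext m x
    refine costructuredArrow_chain_ext rfl fun i ↦ ?_
    refine Eq.trans ?_ (Eq.symm ((congrArg (· ≫ _) (F.map_id _)).trans (Category.id_comp _)))
    exact Category.comp_id _
  map_comp f g := by
    ext m x
    refine costructuredArrow_chain_ext rfl fun i ↦ ?_
    refine Eq.trans ?_ (Eq.symm ((congrArg (· ≫ _) (F.map_id _)).trans (Category.id_comp _)))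
    exact (Category.assoc _ _ _).symm

/-- The maps `N(D/d) ⟶ N(F/F(d))`. -/
def costructuredNerveUnit : overNerve D ⟶ F ⋙ costructuredNerve F where
  app d := nerveMap (CostructuredArrow.post (𝟭 D) F d)
  naturality d e g := by
    ext m x
    refine costructuredArrow_chain_ext rfl fun i ↦ ?_
    refine Eq.trans ?_ (Eq.symm ((congrArg (· ≫ _) (F.map_id _)).trans (Category.id_comp _)))
    exact F.map_comp _ _

/-- The maps `N(F/c) ⟶ N(C/c)`. -/
def costructuredNerveToOver : costructuredNerve F ⟶ overNerve C where
  app c := nerveMap (CostructuredArrow.toOver F c)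
  naturality d e g := by
    ext m x
    refine costructuredArrow_chain_ext (F := 𝟭 C) rfl fun i ↦ ?_
    exact (Category.id_comp _).symm

/-- Under the Kan extension property of `N(F/·)`, restricting a map `N(C/·) ⟶ X` along `F` becomes
precomposition with `N(F/·) ⟶ N(C/·)`. -/
lemma costructuredNerveUnit_toOver :
    costructuredNerveUnit F ≫ Functor.whiskerLeft F (costructuredNerveToOver F) =
      overNerveMap F := by
  ext d m x
  refine costructuredArrow_chain_ext (F := 𝟭 C) rfl fun i ↦ ?_
  exact (Category.id_comp _).symm

lemma costructuredNerveUnit_tautChain {m : SimplexCategoryᵒᵖ} (σ : (nerve D).obj m) :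
    ((costructuredNerveUnit F).app (σ.obj (Fin.last _))).app m (tautChain (𝟭 D) σ) =
      tautChain F σ := by
  refine costructuredArrow_chain_ext rfl fun i ↦ ?_
  exact (Eq.symm ((congrArg (· ≫ _) (F.map_id _)).trans (Category.id_comp _)))

variable {F} {X : C ⥤ SSet.{0}}

lemma map_comp_app_apply (X : C ⥤ SSet.{0}) {a b c : C} (u : a ⟶ b) (v : b ⟶ c)
    {m : SimplexCategoryᵒᵖ} (y : (X.obj a).obj m) :
    (X.map (u ≫ v)).app m y = (X.map v).app m ((X.map u).app m y) := by
  rw [X.map_comp]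
  rfl

/-- The extension to `c ↦ N(F/c)` of a map of diagrams defined on `d ↦ N(D/d)`. -/
def costructuredNerveDesc (φ : overNerve D ⟶ F ⋙ X) : costructuredNerve F ⟶ X where
  app c :=
    { app m := ↾fun y ↦ (X.map (y.obj (Fin.last _)).hom).app m
        (baseSimplex φ ((nerveMap (CostructuredArrow.proj F c)).app m y))
      naturality m m' η := by
        ext y
        let ρ : (nerve D).obj m := (nerveMap (CostructuredArrow.proj F c)).app m y
        have hw : (y.obj (η.unop.toOrderHom (Fin.last _))).hom =
            F.map (ρ.map (homOfLE (Fin.le_last (η.unop.toOrderHom (Fin.last _))))) ≫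
              (y.obj (Fin.last _)).hom :=
          (CostructuredArrow.w (y.map (homOfLE (Fin.le_last _)))).symm
        change (X.map (y.obj (η.unop.toOrderHom (Fin.last _))).hom).app m' _ =
          (X.obj c).map η ((X.map (y.obj (Fin.last _)).hom).app m _)
        rw [hw]
        refine (map_comp_app_apply X (F.map (ρ.map (homOfLE
          (Fin.le_last (η.unop.toOrderHom (Fin.last _)))))) (y.obj (Fin.last _)).hom _).trans ?_
        refine Eq.trans ?_ (NatTrans.naturality_apply (X.map (y.obj (Fin.last _)).hom) η _)
        exact congrArg ((X.map _).app m') (map_baseSimplex φ η ρ) }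
  naturality c c' g := by
    ext m y
    exact map_comp_app_apply X (y.obj (Fin.last _)).hom g _

/-- Existence half of the universal property of `N(F/·)` as left Kan extension of `N(D/·)`;
`costructuredNerve_hom_ext` is the uniqueness half. -/
lemma costructuredNerveUnit_desc (φ : overNerve D ⟶ F ⋙ X) :
    costructuredNerveUnit F ≫ Functor.whiskerLeft F (costructuredNerveDesc φ) = φ := by
  ext d m x
  refine (ConcreteCategory.congr_hom (congr_app (φ.naturality (x.obj (Fin.last _)).hom) m)
    (tautChain (𝟭 D) ((nerveMap (CostructuredArrow.proj (𝟭 D) d)).app m x))).symm.trans ?_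
  exact congrArg ((φ.app d).app m) (map_tautChain_proj (𝟭 D) x)

lemma costructuredNerve_simplex {c : C} {m : SimplexCategoryᵒᵖ}
    (y : ((costructuredNerve F).obj c).obj m) :
    ∃ (d : D) (g : F.obj d ⟶ c) (t : ((overNerve D).obj d).obj m),
      y = ((costructuredNerve F).map g).app m (((costructuredNerveUnit F).app d).app m t) :=
  ⟨_, ComposableArrows.right (C := CostructuredArrow F c) y |>.hom, _,
    (map_tautChain_proj F y).symm.trans (congrArg
      (((costructuredNerve F).map _).app m) (costructuredNerveUnit_tautChain F _).symm)⟩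

lemma costructuredNerve_hom_ext {a b : costructuredNerve F ⟶ X}
    (h : costructuredNerveUnit F ≫ Functor.whiskerLeft F a =
      costructuredNerveUnit F ≫ Functor.whiskerLeft F b) : a = b := by
  ext c m y
  obtain ⟨d, g, t, rfl⟩ := costructuredNerve_simplex y
  refine (ConcreteCategory.congr_hom (congr_app (a.naturality g) m) _).trans ?_
  refine Eq.trans ?_ (ConcreteCategory.congr_hom (congr_app (b.naturality g) m) _).symm
  exact congrArg ((X.map g).app m) (ConcreteCategory.congr_hom (congr_app (congr_app h d) m) t)

/-- The universal property is applied to maps into the path diagram `X^Δ[1]`; the ends are then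
checked on simplices that come from the unit. -/
lemma costructuredNerve_diagramHomotopic {a b : costructuredNerve F ⟶ X}
    (h : DiagramHomotopic (costructuredNerveUnit F ≫ Functor.whiskerLeft F a)
      (costructuredNerveUnit F ≫ Functor.whiskerLeft F b)) : DiagramHomotopic a b := by
  obtain ⟨H, hH⟩ := h
  let l : costructuredNerve F ⋙ tensorLeft Δ[1] ⟶ X :=
    uncurryDiagram (costructuredNerveDesc (X := X ⋙ ihom Δ[1]) (curryDiagram H))
  have hl (d : D) : Δ[1] ◁ (costructuredNerveUnit F).app d ≫ l.app (F.obj d) = H.app d := by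
    refine (MonoidalClosed.uncurry_natural_left _ _).symm.trans ?_
    refine (congrArg MonoidalClosed.uncurry (congr_app (costructuredNerveUnit_desc
      (X := X ⋙ ihom Δ[1]) (curryDiagram H)) d)).trans ?_
    exact MonoidalClosed.uncurry_curry _
  have key (k : Fin 2) {c : C} {m : SimplexCategoryᵒᵖ} (d : D) (g : F.obj d ⟶ c)
      (t : ((overNerve D).obj d).obj m) :
      (l.app c).app m (SSet.stdSimplex.const 1 k m,
        ((costructuredNerve F).map g).app m (((costructuredNerveUnit F).app d).app m t)) =
      (X.map g).app m ((H.app d).app m (SSet.stdSimplex.const 1 k m, t)) := by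
    refine (congrArg (fun φ : Δ[1] ⊗ (costructuredNerve F).obj (F.obj d) ⟶ X.obj c ↦ φ.app m
      (SSet.stdSimplex.const 1 k m, ((costructuredNerveUnit F).app d).app m t))
      (l.naturality g)).trans ?_
    exact congrArg ((X.map g).app m) (congrArg
      (fun φ : Δ[1] ⊗ (overNerve D).obj d ⟶ X.obj (F.obj d) ↦ φ.app m (_, t)) (hl d))
  refine ⟨l, fun c ↦ ⟨fun m y ↦ ?_, fun m y ↦ ?_⟩⟩
  · obtain ⟨d, g, t, rfl⟩ := costructuredNerve_simplex y
    rw [key, (hH d).1]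
    exact (ConcreteCategory.congr_hom (congr_app (a.naturality g) m) _).symm
  · obtain ⟨d, g, t, rfl⟩ := costructuredNerve_simplex y
    rw [key, (hH d).2]
    exact (ConcreteCategory.congr_hom (congr_app (b.naturality g) m) _).symm

end CostructuredNerve

end

end CosimplicialDescent

namespace CosimplicialDescent

noncomputable section

open Limits HomotopicalAlgebra SSet.modelCategoryQuillen

/-! ### Restriction along a left cofinal functor, up to homotopy -/

section Cofinal

variable {C D : Type} [SmallCategory C] [SmallCategory D]

lemma diagramHomotopic_refl {A X : C ⥤ SSet.{0}} (f : A ⟶ X) : DiagramHomotopic f f :=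
  ⟨{ app c := CartesianMonoidalCategory.snd _ _ ≫ f.app c
     naturality c d g := by
       ext m ⟨s, a⟩
       exact ConcreteCategory.congr_hom (congr_app (f.naturality g) m) a },
    fun _ ↦ ⟨fun _ _ ↦ rfl, fun _ _ ↦ rfl⟩⟩

/-- A projective anodyne map out of an objectwise contractible diagram has objectwise acyclic
target. -/
lemma exists_acyclic_replacement {W : C ⥤ SSet.{0}} (hW : ∀ c, IsContractible (W.obj c)) :
    ∃ (Z : C ⥤ SSet.{0}) (j : W ⟶ Z), IsDiagramAnodyne j ∧ (∀ c, SSet.KanComplex (Z.obj c)) ∧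
      ∀ c, IsAcyclicKan (Z.obj c) := by
  obtain ⟨Z, j, hj, hZ⟩ := exists_fibrant_replacement W
  refine ⟨Z, j, hj, hZ, fun c ↦ ?_⟩
  have := hZ c
  exact (hW c).isAcyclicKan (hj.app c)

lemma isContractible_overNerve (c : C) : IsContractible ((overNerve C).obj c) :=
  isContractible_nerve_of_isTerminal (D := Over c) Over.mkIdTerminal

/-- Restriction of maps of diagrams along a functor. -/
abbrev restrictHom (F : D ⥤ C) {X : C ⥤ SSet.{0}} (ψ : overNerve C ⟶ X) : overNerve D ⟶ F ⋙ X :=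
  overNerveMap F ≫ Functor.whiskerLeft F ψ

/-- The inverse sends `φ` to its Kan extension `N(F/·) ⟶ X`, extended over an acyclic Kan
replacement `Z` of `N(F/·)` and precomposed with some `s : N(C/·) ⟶ Z`. Any two maps from a
cofibrant diagram to an acyclic one are homotopic, which proves both round trips. -/
lemma IsLeftCofinal.exists_homotopy_inverse {F : D ⥤ C} (hF : IsLeftCofinal F) {X : C ⥤ SSet.{0}}
    (hX : ∀ c, SSet.KanComplex (X.obj c)) :
    ∃ G : (overNerve D ⟶ F ⋙ X) → (overNerve C ⟶ X),
      (∀ φ φ', DiagramHomotopic φ φ' → DiagramHomotopic (G φ) (G φ')) ∧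
      (∀ ψ, Relation.EqvGen DiagramHomotopic (G (restrictHom F ψ)) ψ) ∧
      ∀ φ, DiagramHomotopic (restrictHom F (G φ)) φ := by
  -- This is where left cofinality enters: it makes `Z` acyclic.
  obtain ⟨Z, j, hj, hZ, hZ'⟩ := exists_acyclic_replacement (W := costructuredNerve F) hF
  obtain ⟨V, jV, hjV, hV, hV'⟩ := exists_acyclic_replacement (isContractible_overNerve (C := C))
  obtain ⟨r, hr⟩ := hj.exists_extension hV (costructuredNerveToOver F ≫ jV)
  obtain ⟨s⟩ := (isCofibrantDiagram_overNerve C).nonempty_hom hZ'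
  choose E hE using fun φ : overNerve D ⟶ F ⋙ X ↦
    hj.exists_extension hX (costructuredNerveDesc φ)
  refine ⟨fun φ ↦ s ≫ E φ, fun φ φ' h ↦ ?_, fun ψ ↦ ?_, fun φ ↦ ?_⟩
  · refine (hj.diagramHomotopic hX ?_).precomp s
    rw [hE, hE]
    apply costructuredNerve_diagramHomotopic
    rwa [costructuredNerveUnit_desc, costructuredNerveUnit_desc]
  · obtain ⟨ψ', hψ⟩ := hjV.exists_extension hX ψ
    -- Both maps restrict along `j` to the composite of `N(F/·) ⟶ N(C/·)` with `ψ`.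
    have h : DiagramHomotopic (E (restrictHom F ψ)) (r ≫ ψ') := by
      apply hj.diagramHomotopic hX
      have h' : j ≫ E (restrictHom F ψ) = j ≫ r ≫ ψ' := by
        rw [hE, ← Category.assoc, hr, Category.assoc, hψ]
        apply costructuredNerve_hom_ext
        rw [costructuredNerveUnit_desc, Functor.whiskerLeft_comp, ← Category.assoc,
          costructuredNerveUnit_toOver]
      rw [h']
      exact diagramHomotopic_refl _
    -- Both `s ≫ r` and `jV` are maps from a cofibrant diagram to the acyclic `V`. The two
    -- homotopies are concatenated only in the generated equivalence relation.
    have h' := ((isCofibrantDiagram_overNerve C).diagramHomotopic hV' (s ≫ r) jV).postcomp ψ'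
    rw [hψ, Category.assoc] at h'
    exact .trans _ _ _ (.rel _ _ (h.precomp s)) (.rel _ _ h')
  -- The two maps `N(D/·) ⟶ F ⋙ Z`, through `s` and through the unit followed by `j`, are homotopic
  -- for the same reason.
  · have h := ((isCofibrantDiagram_overNerve D).diagramHomotopic (Z := F ⋙ Z)
      (fun d ↦ hZ' (F.obj d)) (overNerveMap F ≫ Functor.whiskerLeft F s)
      (costructuredNerveUnit F ≫ Functor.whiskerLeft F j)).postcomp (Functor.whiskerLeft F (E φ))
    rwa [Category.assoc, Category.assoc, ← Functor.whiskerLeft_comp, ← Functor.whiskerLeft_comp,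
      hE, costructuredNerveUnit_desc] at h

end Cofinal

end

end CosimplicialDescent

/-! ### Adjunctions for loop objects and homotopy limits -/

namespace CosimplicialDescent

noncomputable section

open Limits HomotopicalAlgebra SSet.modelCategoryQuillen

/-! ### Tautological simplices -/

/-- The nondegenerate top simplex of the standard simplex. -/
def idSimplex (m : SimplexCategoryᵒᵖ) : (SSet.stdSimplex.obj m.unop : SSet.{0}).obj m :=
  SSet.stdSimplex.objEquiv.symm (𝟙 m.unop)

lemma yonedaEquiv_symm_app_idSimplex {A : SSet.{0}} {m : SimplexCategoryᵒᵖ} (a : A.obj m) :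
    (SSet.yonedaEquiv.symm a : SSet.stdSimplex.obj m.unop ⟶ A).app m (idSimplex m) = a :=
  SSet.yonedaEquiv.apply_symm_apply a

lemma stdSimplex_map_app_idSimplex {m l : SimplexCategoryᵒᵖ} (η : m ⟶ l) :
    (SSet.stdSimplex.map η.unop : SSet.stdSimplex.obj l.unop ⟶ SSet.stdSimplex.obj m.unop).app l
      (idSimplex l) = (SSet.stdSimplex.obj m.unop : SSet.{0}).map η (idSimplex m) := by
  apply SSet.stdSimplex.objEquiv.injective
  exact (Category.id_comp η.unop).trans (Category.comp_id η.unop).symm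

lemma exists_map_idSimplex {m l : SimplexCategoryᵒᵖ}
    (s : (SSet.stdSimplex.obj m.unop : SSet.{0}).obj l) :
    ∃ η : m ⟶ l, s = (SSet.stdSimplex.obj m.unop : SSet.{0}).map η (idSimplex m) :=
  ⟨(SSet.stdSimplex.objEquiv s).op, SSet.stdSimplex.objEquiv.injective
    (Category.comp_id (SSet.stdSimplex.objEquiv s)).symm⟩

lemma yonedaEquiv_symm_app {A : SSet.{0}} {m l : SimplexCategoryᵒᵖ} (a : A.obj m) (η : m ⟶ l) :
    (SSet.yonedaEquiv.symm a : SSet.stdSimplex.obj m.unop ⟶ A).app l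
      ((SSet.stdSimplex.obj m.unop : SSet.{0}).map η (idSimplex m)) = A.map η a := by
  rw [NatTrans.naturality_apply, yonedaEquiv_symm_app_idSimplex]

lemma tensor_naturality {A B X : SSet.{0}} (φ : A ⊗ B ⟶ X) {m l : SimplexCategoryᵒᵖ} (η : m ⟶ l)
    (a : A.obj m) (b : B.obj m) :
    φ.app l (A.map η a, B.map η b) = X.map η (φ.app m (a, b)) :=
  NatTrans.naturality_apply φ η ((a, b) : (A ⊗ B).obj m)

/-! ### Maps into loop objects -/

section Loop

variable {A : SSet.{0}} {B : PSSet}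

/-- The map into the loop object adjoint to a map `A × Δ[1] ⟶ B`. -/
def toLoop (h : A ⊗ Δ[1] ⟶ B.X) (h₀ : SSet.ι₀ ≫ h = SSet.const B.pt)
    (h₁ : SSet.ι₁ ≫ h = SSet.const B.pt) : A ⟶ B.loopSSet where
  app n := ↾fun a ↦ ⟨(SSet.yonedaEquiv.symm a ▷ Δ[1]) ≫ h, by
    rw [SSet.ι₀_comp_assoc, SSet.ι₁_comp_assoc, h₀, h₁]
    exact ⟨rfl, rfl⟩⟩
  naturality n m θ := by
    ext a
    apply Subtype.ext
    change (SSet.yonedaEquiv.symm (A.map θ a) ▷ Δ[1]) ≫ h =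
      (SSet.stdSimplex.map θ.unop ▷ Δ[1]) ≫ (SSet.yonedaEquiv.symm a ▷ Δ[1]) ≫ h
    rw [← Category.assoc, ← comp_whiskerRight, map_comp_yonedaEquiv_symm]

/-- The map `A × Δ[1] ⟶ B` adjoint to a map into the loop object. -/
def ofLoop (f : A ⟶ B.loopSSet) : A ⊗ Δ[1] ⟶ B.X where
  app m := ↾fun x ↦ (f.app m x.1).1.app m (idSimplex m, x.2)
  naturality m l η := by
    ext x
    change (f.app l (A.map η x.1)).1.app l (idSimplex l, Δ[1].map η x.2) = _
    rw [NatTrans.naturality_apply]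
    refine Eq.trans ?_ (tensor_naturality (f.app m x.1).1 η (idSimplex m) x.2)
    exact congrArg (fun s ↦ (f.app m x.1).1.app l (s, Δ[1].map η x.2))
      (stdSimplex_map_app_idSimplex η)

lemma ofLoop_toLoop (h : A ⊗ Δ[1] ⟶ B.X) (h₀ : SSet.ι₀ ≫ h = SSet.const B.pt)
    (h₁ : SSet.ι₁ ≫ h = SSet.const B.pt) : ofLoop (toLoop h h₀ h₁) = h := by
  ext m x
  exact congrArg (fun a ↦ h.app m (a, x.2)) (yonedaEquiv_symm_app_idSimplex x.1)

lemma ι₀_ofLoop (f : A ⟶ B.loopSSet) : SSet.ι₀ ≫ ofLoop f = SSet.const B.pt := by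
  ext m a
  exact congrArg (fun φ : SSet.stdSimplex.obj m.unop ⟶ B.X ↦ φ.app m (idSimplex m))
    (f.app m a).2.1

lemma ι₁_ofLoop (f : A ⟶ B.loopSSet) : SSet.ι₁ ≫ ofLoop f = SSet.const B.pt := by
  ext m a
  exact congrArg (fun φ : SSet.stdSimplex.obj m.unop ⟶ B.X ↦ φ.app m (idSimplex m))
    (f.app m a).2.2

lemma toLoop_ofLoop (f : A ⟶ B.loopSSet) : toLoop (ofLoop f) (ι₀_ofLoop f) (ι₁_ofLoop f) = f := by
  ext m a
  apply Subtype.ext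
  ext l ⟨s, t⟩
  obtain ⟨η, rfl⟩ := exists_map_idSimplex s
  refine (congrArg (fun b ↦ (f.app l b).1.app l (idSimplex l, t))
    (yonedaEquiv_symm_app a η)).trans ?_
  rw [NatTrans.naturality_apply]
  exact congrArg (fun s ↦ (f.app m a).1.app l (s, t)) (stdSimplex_map_app_idSimplex η)

lemma ofLoop_injective {f g : A ⟶ B.loopSSet} (h : ofLoop f = ofLoop g) : f = g := by
  rw [← toLoop_ofLoop f, ← toLoop_ofLoop g]
  congr 1

lemma ofLoop_comp {A' : SSet.{0}} (i : A' ⟶ A) (f : A ⟶ B.loopSSet) :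
    ofLoop (i ≫ f) = i ▷ Δ[1] ≫ ofLoop f := rfl

lemma const_ofLoop_ends (k : Fin 2) (f : A ⟶ B.loopSSet) {m : SimplexCategoryᵒᵖ} (a : A.obj m) :
    (ofLoop f).app m (a, SSet.stdSimplex.const 1 k m) = (SSet.const B.pt : A ⟶ B.X).app m a := by
  obtain rfl | rfl : k = 0 ∨ k = 1 := by omega
  · exact congrArg (fun φ : A ⟶ B.X ↦ φ.app m a) (ι₀_ofLoop f)
  · exact congrArg (fun φ : A ⟶ B.X ↦ φ.app m a) (ι₁_ofLoop f)

lemma eq_const_of_boundary_one {m : SimplexCategoryᵒᵖ} (s : (∂Δ[1] : SSet.{0}).obj m) :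
    s.1 = SSet.stdSimplex.const 1 (SSet.stdSimplex.asOrderHom s.1 0) m := by
  apply SSet.stdSimplex.objEquiv.injective
  ext i : 3
  exact asOrderHom_boundary_one s i 0

/-- A horn in `ΩB` is a map `Λ × Δ[1] ⟶ B` that is constant on `Λ × ∂Δ[1]`. It is extended to
`Δ[n+1] × Δ[1]` together with the constant map on `Δ[n+1] × ∂Δ[1]`, using that `B^Δ[n+1] ⟶ B^Λ` is a
trivial fibration. -/
lemma kanComplex_loop [SSet.KanComplex B.X] : SSet.KanComplex B.loopSSet := by
  refine kanComplex_of_hornFilling fun n i σ₀ ↦ ?_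
  have hr := rlp_I_pre_of_anodyne (Λ[n + 1, i] : Δ[n + 1].Subcomplex)
    (SSet.anodyneExtensions.horn_ι i) B.X
  obtain ⟨l, hl, hl'⟩ := exists_tensor_lift_sset Λ[n + 1, i].ι ∂Δ[1].ι
    (hr _ (boundary_ι_mem_I 1)) (SSet.const B.pt) (ofLoop σ₀) (by
      ext m ⟨a, s⟩
      refine Eq.trans ?_ (congrArg (fun t ↦ (ofLoop σ₀).app m (a, t))
        (eq_const_of_boundary_one s)).symm
      exact (const_ofLoop_ends _ σ₀ a).symm)
  have mem (k : Fin 2) (m : SimplexCategoryᵒᵖ) :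
      SSet.stdSimplex.const 1 k m ∈ (∂Δ[1] : Δ[1].Subcomplex).obj m := by
    intro hs
    obtain ⟨i, hi⟩ := hs 0
    obtain ⟨j, hj⟩ := hs 1
    have hi : k = 0 := hi
    have hj : k = 1 := hj
    omega
  have key (k : Fin 2) (m : SimplexCategoryᵒᵖ) (a : Δ[n + 1].obj m) :
      l.app m (a, SSet.stdSimplex.const 1 k m) = (SSet.const B.pt : Δ[n + 1] ⟶ B.X).app m a :=
    congrArg (fun φ : Δ[n + 1] ⊗ (∂Δ[1] : SSet.{0}) ⟶ B.X ↦ φ.app m (a, ⟨_, mem k m⟩)) hl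
  refine ⟨toLoop l ?_ ?_, ofLoop_injective ?_⟩
  · ext m a
    exact key 0 m a
  · ext m a
    exact key 1 m a
  · rw [ofLoop_comp, ofLoop_toLoop, hl']

end Loop

/-! ### Maps into homotopy limits -/

section HolimMaps

variable {C D : Type} [SmallCategory C] [SmallCategory D] {A : SSet.{0}} {X : C ⥤ PSSet}

/-- The map into the homotopy limit given by a map of diagrams. -/
def toHolim (g : overNerve C ⋙ tensorLeft A ⟶ X ⋙ PSSet.forget) : A ⟶ (holimPSSet X).X where
  app m := ↾fun a ↦ Functor.whiskerLeft (overNerve C)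
    ((tensoringLeft SSet.{0}).map (SSet.yonedaEquiv.symm a)) ≫ g
  naturality m l η := by
    ext a
    refine NatTrans.ext (funext fun c ↦ ?_)
    change (SSet.yonedaEquiv.symm (A.map η a) ▷ (overNerve C).obj c) ≫ g.app c =
      (SSet.stdSimplex.map η.unop ▷ _) ≫ (SSet.yonedaEquiv.symm a ▷ _) ≫ g.app c
    rw [← Category.assoc, ← comp_whiskerRight, map_comp_yonedaEquiv_symm]

/-- The map of diagrams given by a map into the homotopy limit. -/
def ofHolim (f : A ⟶ (holimPSSet X).X) : overNerve C ⋙ tensorLeft A ⟶ X ⋙ PSSet.forget where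
  app c :=
    { app m := ↾fun x ↦ (NatTrans.app (f.app m x.1) c).app m (idSimplex m, x.2)
      naturality m l η := by
        ext x
        change (NatTrans.app (f.app l (A.map η x.1)) c).app l
          (idSimplex l, ((overNerve C).obj c).map η x.2) = _
        rw [NatTrans.naturality_apply]
        refine Eq.trans ?_ (tensor_naturality (NatTrans.app (f.app m x.1) c) η
          (idSimplex m) x.2)
        exact congrArg (fun s ↦ (NatTrans.app (f.app m x.1) c).app l
          (s, ((overNerve C).obj c).map η x.2)) (stdSimplex_map_app_idSimplex η) }
  naturality c d g := by
    ext m x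
    exact congrArg (fun φ : (simplexOverNerve C m.unop).obj c ⟶ (X.obj d).X ↦
      φ.app m (idSimplex m, x.2)) (NatTrans.naturality (f.app m x.1) g)

lemma ofHolim_toHolim (g : overNerve C ⋙ tensorLeft A ⟶ X ⋙ PSSet.forget) :
    ofHolim (toHolim g) = g := by
  ext c m x
  exact congrArg (fun a ↦ (g.app c).app m (a, x.2)) (yonedaEquiv_symm_app_idSimplex x.1)

lemma toHolim_ofHolim (f : A ⟶ (holimPSSet X).X) : toHolim (ofHolim f) = f := by
  ext m a
  refine NatTrans.ext (funext fun c ↦ ?_)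
  ext l ⟨s, v⟩
  obtain ⟨η, rfl⟩ := exists_map_idSimplex s
  refine (congrArg (fun b ↦ (NatTrans.app (f.app l b) c).app l (idSimplex l, v))
    (yonedaEquiv_symm_app a η)).trans ?_
  rw [NatTrans.naturality_apply]
  exact congrArg (fun s ↦ (NatTrans.app (f.app m a) c).app l (s, v))
    (stdSimplex_map_app_idSimplex η)

lemma ofHolim_injective {f g : A ⟶ (holimPSSet X).X} (h : ofHolim f = ofHolim g) : f = g := by
  rw [← toHolim_ofHolim f, ← toHolim_ofHolim g, h]

/-- By adjunction a natural map on `Λ × N(C/·)` has to be extended to `Δ[n+1] × N(C/·)`. This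
follows from cofibrancy of `N(C/·)`, since `X^Δ[n+1] ⟶ X^Λ` is an objectwise trivial fibration. -/
lemma kanComplex_holim (hX : ∀ c, SSet.KanComplex (X.obj c).X) :
    SSet.KanComplex (holimPSSet X).X := by
  refine kanComplex_of_hornFilling fun n i σ₀ ↦ ?_
  obtain ⟨l, hl⟩ := (isCofibrantDiagram_overNerve C).exists_tensor_lift Λ[n + 1, i].ι
    (X ⋙ PSSet.forget) (fun c ↦ by
      have := hX c
      exact rlp_I_pre_of_anodyne (Λ[n + 1, i] : Δ[n + 1].Subcomplex)
        (SSet.anodyneExtensions.horn_ι i) (X.obj c).X) (ofHolim σ₀)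
  refine ⟨toHolim l, ofHolim_injective ?_⟩
  refine NatTrans.ext (funext fun c ↦ ?_)
  refine Eq.trans ?_ (hl c)
  exact congrArg (Λ[n + 1, i].ι ▷ (overNerve C).obj c ≫ ·) (congr_app (ofHolim_toHolim l) c)

end HolimMaps

end

end CosimplicialDescent

namespace CosimplicialDescent

noncomputable section

open Limits HomotopicalAlgebra SSet.modelCategoryQuillen

section HolimRestrict

variable {C D : Type} [SmallCategory C] [SmallCategory D]

/-! ### Loops commute with homotopy limits -/

/-- The exchange of the last two factors. -/
abbrev swapLast (A B K : SSet.{0}) : (A ⊗ B) ⊗ K ⟶ (A ⊗ K) ⊗ B :=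
  CartesianMonoidalCategory.lift
    (CartesianMonoidalCategory.lift
      (CartesianMonoidalCategory.fst _ _ ≫ CartesianMonoidalCategory.fst _ _)
      (CartesianMonoidalCategory.snd _ _))
    (CartesianMonoidalCategory.fst _ _ ≫ CartesianMonoidalCategory.snd _ _)

section

variable {A : SSet.{0}} {X : C ⥤ PSSet}

/-- A component of `loopHolimHom`. -/
def loopHolimApp (φ : A ⊗ Δ[1] ⟶ (holimPSSet X).X)
    (h₀ : SSet.ι₀ ≫ φ = SSet.const (holimPSSet X).pt)
    (h₁ : SSet.ι₁ ≫ φ = SSet.const (holimPSSet X).pt) (c : C) :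
    A ⊗ (overNerve C).obj c ⟶ (X.obj c).loopSSet :=
  toLoop (swapLast A ((overNerve C).obj c) Δ[1] ≫ (ofHolim φ).app c)
    (by
      ext m x
      exact congrArg (fun f : A ⟶ (holimPSSet X).X ↦
        (NatTrans.app (f.app m x.1) c).app m (idSimplex m, x.2)) h₀)
    (by
      ext m x
      exact congrArg (fun f : A ⟶ (holimPSSet X).X ↦
        (NatTrans.app (f.app m x.1) c).app m (idSimplex m, x.2)) h₁)

lemma ofLoop_loopHolimApp (φ : A ⊗ Δ[1] ⟶ (holimPSSet X).X)
    (h₀ : SSet.ι₀ ≫ φ = SSet.const (holimPSSet X).pt)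
    (h₁ : SSet.ι₁ ≫ φ = SSet.const (holimPSSet X).pt) (c : C) :
    ofLoop (loopHolimApp φ h₀ h₁ c) =
      swapLast A ((overNerve C).obj c) Δ[1] ≫ (ofHolim φ).app c :=
  ofLoop_toLoop _ _ _

/-- A family of loops in a homotopy limit, as a map into the homotopy limit of the loop objects. -/
def loopHolimHom (φ : A ⊗ Δ[1] ⟶ (holimPSSet X).X)
    (h₀ : SSet.ι₀ ≫ φ = SSet.const (holimPSSet X).pt)
    (h₁ : SSet.ι₁ ≫ φ = SSet.const (holimPSSet X).pt) :
    overNerve C ⋙ tensorLeft A ⟶ (X ⋙ PSSet.loop) ⋙ PSSet.forget where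
  app c := loopHolimApp φ h₀ h₁ c
  naturality c d g := by
    apply ofLoop_injective
    refine (congrArg ((A ◁ (overNerve C).map g) ▷ Δ[1] ≫ ·)
      (ofLoop_loopHolimApp φ h₀ h₁ d)).trans ?_
    refine Eq.trans ?_ (congrArg (· ≫ (X.map g).map) (ofLoop_loopHolimApp φ h₀ h₁ c)).symm
    exact congrArg (swapLast A ((overNerve C).obj c) Δ[1] ≫ ·) ((ofHolim φ).naturality g)

/-- A map into the homotopy limit of the loop objects, as a family of loops in the homotopy
limit. -/
def loopHolimInv (ψ : overNerve C ⋙ tensorLeft A ⟶ (X ⋙ PSSet.loop) ⋙ PSSet.forget) :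
    A ⊗ Δ[1] ⟶ (holimPSSet X).X :=
  toHolim
    { app c := swapLast A Δ[1] ((overNerve C).obj c) ≫ ofLoop (ψ.app c)
      naturality c d g :=
        congrArg (fun f : A ⊗ (overNerve C).obj c ⟶ (X.obj d).loopSSet ↦
          swapLast A Δ[1] ((overNerve C).obj c) ≫ ofLoop f) (ψ.naturality g) }

lemma ofHolim_loopHolimInv
    (ψ : overNerve C ⋙ tensorLeft A ⟶ (X ⋙ PSSet.loop) ⋙ PSSet.forget) :
    ofHolim (loopHolimInv ψ) =
      { app c := swapLast A Δ[1] ((overNerve C).obj c) ≫ ofLoop (ψ.app c)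
        naturality c d g :=
          congrArg (fun f : A ⊗ (overNerve C).obj c ⟶ (X.obj d).loopSSet ↦
            swapLast A Δ[1] ((overNerve C).obj c) ≫ ofLoop f) (ψ.naturality g) } :=
  ofHolim_toHolim _

lemma ι₀_loopHolimInv (ψ : overNerve C ⋙ tensorLeft A ⟶ (X ⋙ PSSet.loop) ⋙ PSSet.forget) :
    SSet.ι₀ ≫ loopHolimInv ψ = SSet.const (holimPSSet X).pt := by
  ext m a
  refine NatTrans.ext (funext fun c ↦ ?_)
  ext l ⟨s, v⟩
  exact const_ofLoop_ends 0 (ψ.app c) ((SSet.yonedaEquiv.symm a).app l s, v)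

lemma ι₁_loopHolimInv (ψ : overNerve C ⋙ tensorLeft A ⟶ (X ⋙ PSSet.loop) ⋙ PSSet.forget) :
    SSet.ι₁ ≫ loopHolimInv ψ = SSet.const (holimPSSet X).pt := by
  ext m a
  refine NatTrans.ext (funext fun c ↦ ?_)
  ext l ⟨s, v⟩
  exact const_ofLoop_ends 1 (ψ.app c) ((SSet.yonedaEquiv.symm a).app l s, v)

lemma loopHolimInv_hom (φ : A ⊗ Δ[1] ⟶ (holimPSSet X).X)
    (h₀ : SSet.ι₀ ≫ φ = SSet.const (holimPSSet X).pt)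
    (h₁ : SSet.ι₁ ≫ φ = SSet.const (holimPSSet X).pt) :
    loopHolimInv (loopHolimHom φ h₀ h₁) = φ := by
  apply ofHolim_injective
  refine (ofHolim_toHolim _).trans (NatTrans.ext (funext fun c ↦ ?_))
  exact congrArg (swapLast A Δ[1] ((overNerve C).obj c) ≫ ·) (ofLoop_loopHolimApp φ h₀ h₁ c)

lemma loopHolimHom_inv (ψ : overNerve C ⋙ tensorLeft A ⟶ (X ⋙ PSSet.loop) ⋙ PSSet.forget) :
    loopHolimHom (loopHolimInv ψ) (ι₀_loopHolimInv ψ) (ι₁_loopHolimInv ψ) = ψ := by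
  refine NatTrans.ext (funext fun c ↦ ofLoop_injective ?_)
  refine (ofLoop_loopHolimApp (loopHolimInv ψ) (ι₀_loopHolimInv ψ) (ι₁_loopHolimInv ψ) c).trans ?_
  exact congrArg (swapLast A ((overNerve C).obj c) Δ[1] ≫ ·) (congr_app (ofHolim_toHolim _) c)

end

/-- Loops commute with homotopy limits. -/
def loopHolimIso (X : C ⥤ PSSet) :
    PSSet.loop.obj (holimPSSet X) ≅ holimPSSet (X ⋙ PSSet.loop) where
  hom :=
    { map :=
        { app n := ↾fun φ ↦ loopHolimHom φ.1 φ.2.1 φ.2.2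
          naturality n m θ := by
            ext φ
            refine NatTrans.ext (funext fun c ↦ ofLoop_injective ?_)
            have h := ((PSSet.loop.obj (holimPSSet X)).X.map θ φ).2
            refine (ofLoop_loopHolimApp _ h.1 h.2 c).trans ?_
            exact (congrArg ((SSet.stdSimplex.map θ.unop ▷ (overNerve C).obj c) ▷ Δ[1] ≫ ·)
              (ofLoop_loopHolimApp φ.1 φ.2.1 φ.2.2 c)).symm }
      map_pt := by
        refine NatTrans.ext (funext fun c ↦ ofLoop_injective ?_)
        have h := (PSSet.loop.obj (holimPSSet X)).pt.2
        exact ofLoop_loopHolimApp _ h.1 h.2 c }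
  inv :=
    { map :=
        { app n := ↾fun ψ ↦ ⟨loopHolimInv ψ, ι₀_loopHolimInv ψ, ι₁_loopHolimInv ψ⟩
          naturality n m θ := by
            ext ψ
            apply Subtype.ext
            apply ofHolim_injective
            refine (ofHolim_toHolim _).trans ?_
            refine NatTrans.ext (funext fun c ↦ ?_)
            exact (congrArg (fun ξ : overNerve C ⋙ tensorLeft (SSet.stdSimplex.obj n.unop ⊗ Δ[1]) ⟶
                X ⋙ PSSet.forget ↦
              (SSet.stdSimplex.map θ.unop ▷ Δ[1]) ▷ (overNerve C).obj c ≫ ξ.app c)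
              (ofHolim_loopHolimInv ψ)).symm }
      map_pt := by
        apply Subtype.ext
        apply ofHolim_injective
        exact ofHolim_toHolim _ }
  hom_inv_id := by
    apply PSSet.hom_ext
    ext n φ
    exact Subtype.ext (loopHolimInv_hom φ.1 φ.2.1 φ.2.2)
  inv_hom_id := by
    apply PSSet.hom_ext
    ext n ψ
    exact loopHolimHom_inv ψ

/-! ### The restriction map on connected components -/

/-- The restriction map of homotopy limits of pointed simplicial sets. -/
def holimPSSetRestrict (F : D ⥤ C) (X : C ⥤ PSSet) : holimPSSet X ⟶ holimPSSet (F ⋙ X) where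
  map :=
    { app n := ↾fun α ↦
        Functor.whiskerRight (overNerveMap F) (tensorLeft (SSet.stdSimplex.obj n.unop)) ≫
          Functor.whiskerLeft F α
      naturality n m θ := by
        ext α
        rfl }
  map_pt := rfl

/-- Naturality of `loopHolimIso` under restriction, needed to carry the `π₀` statement to iterated
loops. -/
lemma loopHolimIso_restrict (F : D ⥤ C) (X : C ⥤ PSSet) :
    PSSet.loop.map (holimPSSetRestrict F X) ≫ (loopHolimIso (F ⋙ X)).hom =
      (loopHolimIso X).hom ≫ holimPSSetRestrict F (X ⋙ PSSet.loop) := by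
  apply PSSet.hom_ext
  ext n φ
  refine NatTrans.ext (funext fun c ↦ ofLoop_injective ?_)
  have h := ((PSSet.loop.map (holimPSSetRestrict F X)).map.app n φ).2
  refine (ofLoop_loopHolimApp _ h.1 h.2 c).trans ?_
  exact (congrArg ((SSet.stdSimplex.obj n.unop ◁ (overNerveMap F).app c) ▷ Δ[1] ≫ ·)
    (ofLoop_loopHolimApp φ.1 φ.2.1 φ.2.2 (F.obj c))).symm

variable {X : C ⥤ PSSet}

/-- The map of diagrams given by a vertex of the homotopy limit. -/
def holimVertexHom (α : (holimPSSet X).X _⦋0⦌) : overNerve C ⟶ X ⋙ PSSet.forget where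
  app c :=
    { app m := ↾fun v ↦ (NatTrans.app α c).app m (SSet.stdSimplex.const 0 0 m, v)
      naturality m l η := by
        ext v
        exact tensor_naturality (NatTrans.app α c) η (SSet.stdSimplex.const 0 0 m) v }
  naturality c d g := by
    ext m v
    exact congrArg (fun φ : (simplexOverNerve C ⦋0⦌).obj c ⟶ (X.obj d).X ↦
      φ.app m (SSet.stdSimplex.const 0 0 m, v)) (NatTrans.naturality α g)

/-- The vertex of the homotopy limit given by a map of diagrams. -/
def holimVertex (ψ : overNerve C ⟶ X ⋙ PSSet.forget) : (holimPSSet X).X _⦋0⦌ :=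
  { app c := CartesianMonoidalCategory.snd _ _ ≫ ψ.app c
    naturality c d g := by
      ext m ⟨s, a⟩
      exact ConcreteCategory.congr_hom (congr_app (ψ.naturality g) m) a :
    simplexOverNerve C ⦋0⦌ ⟶ X ⋙ PSSet.forget }

/-- An edge of the homotopy limit is a natural map `Δ[1] × N(C/·) ⟶ X`, that is, a natural homotopy.
What remains is to identify `Δ[0] × N(C/·)` with `N(C/·)` at its ends. -/
lemma π₀Rel_holim_iff (α β : (holimPSSet X).X _⦋0⦌) :
    SSet.π₀Rel α β ↔ DiagramHomotopic (holimVertexHom α) (holimVertexHom β) := by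
  constructor
  · rintro ⟨e⟩
    refine ⟨e.edge, fun c ↦ ⟨fun m v ↦ ?_, fun m v ↦ ?_⟩⟩
    · refine Eq.trans ?_ (congrArg (fun γ : (holimPSSet X).X _⦋0⦌ ↦
        (NatTrans.app γ c).app m (SSet.stdSimplex.const 0 0 m, v)) e.src_eq)
      refine congrArg (fun s ↦ (NatTrans.app e.edge c).app m (s, v)) ?_
      apply SSet.stdSimplex.objEquiv.injective
      ext i : 3
      rfl
    · refine Eq.trans ?_ (congrArg (fun γ : (holimPSSet X).X _⦋0⦌ ↦
        (NatTrans.app γ c).app m (SSet.stdSimplex.const 0 0 m, v)) e.tgt_eq)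
      refine congrArg (fun s ↦ (NatTrans.app e.edge c).app m (s, v)) ?_
      apply SSet.stdSimplex.objEquiv.injective
      ext i : 3
      rfl
  · rintro ⟨H, hH⟩
    have hs {m : SimplexCategoryᵒᵖ} (s : Δ[0].obj m) : s = SSet.stdSimplex.const 0 0 m := by
      apply SSet.stdSimplex.objEquiv.injective
      ext i : 3
      exact Subsingleton.elim (α := Fin 1) _ _
    refine ⟨SSet.Edge.mk (H : simplexOverNerve C ⦋1⦌ ⟶ X ⋙ PSSet.forget) ?_ ?_⟩
    · refine NatTrans.ext (funext fun c ↦ ?_)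
      ext m ⟨s, v⟩
      obtain rfl := hs s
      refine Eq.trans ?_ ((hH c).1 m v)
      refine congrArg (fun s ↦ (NatTrans.app H c).app m (s, v)) ?_
      apply SSet.stdSimplex.objEquiv.injective
      ext i : 3
      rfl
    · refine NatTrans.ext (funext fun c ↦ ?_)
      ext m ⟨s, v⟩
      obtain rfl := hs s
      refine Eq.trans ?_ ((hH c).2 m v)
      refine congrArg (fun s ↦ (NatTrans.app H c).app m (s, v)) ?_
      apply SSet.stdSimplex.objEquiv.injective
      ext i : 3
      rfl

lemma eqvGen_map {α β : Type*} {r : α → α → Prop} {s : β → β → Prop} (f : α → β)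
    (h : ∀ a b, r a b → Relation.EqvGen s (f a) (f b)) {a b : α} (hab : Relation.EqvGen r a b) :
    Relation.EqvGen s (f a) (f b) := by
  induction hab with
  | rel a b hab => exact h a b hab
  | refl a => exact .refl _
  | symm a b _ ih => exact .symm _ _ ih
  | trans a b c _ _ ih ih' => exact .trans _ _ _ ih ih'

/-! ### Left cofinal restriction on homotopy groups -/

lemma IsLeftCofinal.bijective_mapπ₀ {F : D ⥤ C} (hF : IsLeftCofinal F)
    (hX : ∀ c, SSet.KanComplex (X.obj c).X) :
    Function.Bijective (SSet.mapπ₀ (holimPSSetRestrict F X).map) := by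
  obtain ⟨G, hG, hG', hG''⟩ := hF.exists_homotopy_inverse (X := X ⋙ PSSet.forget) hX
  constructor
  · intro x y hxy
    obtain ⟨α, rfl⟩ := SSet.π₀.mk_surjective x
    obtain ⟨β, rfl⟩ := SSet.π₀.mk_surjective y
    rw [SSet.mapπ₀_mk, SSet.mapπ₀_mk, SSet.π₀.mk_eq_mk_iff] at hxy
    -- Equality in `π₀` is a zigzag of edges, so the homotopy inverse is applied edge by edge.
    have h : Relation.EqvGen DiagramHomotopic
        (G (restrictHom F (X := X ⋙ PSSet.forget) (holimVertexHom α)))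
        (G (restrictHom F (X := X ⋙ PSSet.forget) (holimVertexHom β))) :=
      eqvGen_map (fun γ ↦ G (holimVertexHom γ)) (fun γ γ' h ↦
        .rel _ _ (hG _ _ ((π₀Rel_holim_iff γ γ').1 h))) hxy
    have h' := (Relation.EqvGen.symm _ _ (hG' _)).trans _ _ _ (h.trans _ _ _ (hG' _))
    rw [SSet.π₀.mk_eq_mk_iff]
    -- A vertex is a map on `Δ[0] × N(C/·)`; passing to `N(C/·)` and back stays in its component.
    have hv (γ : (holimPSSet X).X _⦋0⦌) :
        Relation.EqvGen SSet.π₀Rel γ (holimVertex (holimVertexHom γ)) :=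
      .rel _ _ ((π₀Rel_holim_iff _ _).2 (diagramHomotopic_refl _))
    have h'' : Relation.EqvGen SSet.π₀Rel (holimVertex (holimVertexHom α))
        (holimVertex (holimVertexHom β)) :=
      eqvGen_map holimVertex (fun ψ ψ' h ↦ .rel _ _ ((π₀Rel_holim_iff _ _).2 h)) h'
    exact (hv α).trans _ _ _ (h''.trans _ _ _ (.symm _ _ (hv β)))
  · intro y
    obtain ⟨β, rfl⟩ := SSet.π₀.mk_surjective y
    refine ⟨SSet.π₀.mk (holimVertex (G (holimVertexHom β))), ?_⟩
    rw [SSet.mapπ₀_mk, SSet.π₀.mk_eq_mk_iff]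
    exact .rel _ _ ((π₀Rel_holim_iff _ _).2 (hG'' (holimVertexHom β)))

/-- Induction through `Ωᵐ⁺¹ = Ωᵐ ∘ Ω`: the inner loop moves inside the homotopy limit, and the
diagram of loop objects is again objectwise Kan. Hence the quantification over all `X`. -/
lemma IsLeftCofinal.isIso_loopIter {F : D ⥤ C} (hF : IsLeftCofinal F) (m : ℕ) :
    ∀ X : C ⥤ PSSet, (∀ c, SSet.KanComplex (X.obj c).X) →
      IsIso ((PSSet.loopIter m ⋙ PSSet.forget ⋙ SSet.π₀Functor).map (holimPSSetRestrict F X)) := by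
  induction m with
  | zero => exact fun X hX ↦ (isIso_iff_bijective _).2 (hF.bijective_mapπ₀ hX)
  | succ m ih =>
    intro X hX
    have h := ih (X ⋙ PSSet.loop) fun c ↦ by
      have := hX c
      exact kanComplex_loop (B := X.obj c)
    have h' : PSSet.loop.map (holimPSSetRestrict F X) = (loopHolimIso X).hom ≫
        holimPSSetRestrict F (X ⋙ PSSet.loop) ≫ (loopHolimIso (F ⋙ X)).inv := by
      rw [← Category.assoc, ← loopHolimIso_restrict, Category.assoc, Iso.hom_inv_id,
        Category.comp_id]
    change IsIso ((PSSet.loopIter m ⋙ PSSet.forget ⋙ SSet.π₀Functor).map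
      (PSSet.loop.map (holimPSSetRestrict F X)))
    rw [h', Functor.map_comp, Functor.map_comp]
    infer_instance

lemma weakEquiv_id (A : SSet.{0}) : WeakEquiv (𝟙 A) := fun K _ ↦
  ⟨fun g ↦ ⟨g, by
    rw [Category.id_comp]
    exact (homotopy_equivalence A K).refl g⟩, fun h h' H ↦ by
    rwa [Category.id_comp, Category.id_comp] at H⟩

/-- Restriction along a left cofinal functor is a stable equivalence of homotopy limits of
diagrams of levelwise Kan spectra. -/
lemma IsLeftCofinal.isStableEquiv_holimRestrict {F : D ⥤ C} (hF : IsLeftCofinal F)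
    (Y : C ⥤ Spectrum) (hY : ∀ c, (Y.obj c).IsLevelKan) :
    Spectrum.IsStableEquiv (holimRestrict F Y) := by
  -- Both homotopy limits already have Kan levels, so identities serve as the replacements.
  refine ⟨holim Y, holim (F ⋙ Y), 𝟙 _, 𝟙 _, holimRestrict F Y, ?_, fun k ↦ weakEquiv_id _,
    fun k ↦ weakEquiv_id _, fun k ↦ kanComplex_holim fun c ↦ hY c k,
    fun k ↦ kanComplex_holim fun d ↦ hY (F.obj d) k, fun i j ↦ ?_⟩
  · rw [Category.id_comp, Category.comp_id]
  -- The comparison is an isomorphism at every stage, already before the colimit.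
  · have (n : ℕ) : IsIso ((Spectrum.piSeqMap i j (holimRestrict F Y)).app n) :=
      hF.isIso_loopIter (j + n) (Y ⋙ Spectrum.levelFunctor (i + n)) fun c ↦ hY c (i + n)
    have := NatIso.isIso_of_isIso_app (Spectrum.piSeqMap i j (holimRestrict F Y))
    exact (isIso_iff_bijective _).1
      (inferInstanceAs (IsIso (colim.map (Spectrum.piSeqMap i j (holimRestrict F Y)))))

end HolimRestrict

end

end CosimplicialDescent

/-! ### Contractibility of the left fibers -/

namespace CosimplicialDescent

noncomputable section

open Limits

/-! ### The complex of chains -/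

/-- Two points of `ℕ × ℕ` are equal or comparable for the order `(t, a) < (t', a')` given by
`t < t'` and `a ≤ a'`. -/
def ChainComparable (x y : ℕ × ℕ) : Prop :=
  (x.1 = y.1 ∧ x.2 = y.2) ∨ (x.1 < y.1 ∧ x.2 ≤ y.2) ∨ (y.1 < x.1 ∧ y.2 ≤ x.2)

/-- The finite nonempty chains in `S × {0, …, q}`. -/
abbrev ChainPoset (S : Set ℕ) (q : ℕ) : Type :=
  { G : Finset (ℕ × ℕ) // G.Nonempty ∧ (∀ x ∈ G, x.1 ∈ S ∧ x.2 ≤ q) ∧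
    ∀ x ∈ G, ∀ y ∈ G, ChainComparable x y }

section ChainMaps

variable {S : Set ℕ} {q : ℕ}

variable (S q) in
/-- Two self maps of `S × {0, …, q}` send pairs of comparable points to pairs of comparable
points. -/
structure Contiguous (f g : ℕ × ℕ → ℕ × ℕ) : Prop where
  mem (x : ℕ × ℕ) (hx : x.1 ∈ S) (hx' : x.2 ≤ q) : (f x).1 ∈ S ∧ (f x).2 ≤ q
  comparable (x y : ℕ × ℕ) (hx : x.1 ∈ S) (hx' : x.2 ≤ q) (hy : y.1 ∈ S) (hy' : y.2 ≤ q)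
    (h : ChainComparable x y) : ChainComparable (f x) (g y)

lemma ChainComparable.symm {x y : ℕ × ℕ} (h : ChainComparable x y) : ChainComparable y x := by
  unfold ChainComparable at h ⊢
  omega

/-- The self map of the poset of chains induced by a map of points. -/
def chainImage {f : ℕ × ℕ → ℕ × ℕ} (hf : Contiguous S q f f) : ChainPoset S q ⥤ ChainPoset S q :=
  Monotone.functor (f := fun G ↦ ⟨G.1.image f, G.2.1.image f,
    by
      simp only [Finset.forall_mem_image]
      exact fun x hx ↦ hf.mem x (G.2.2.1 x hx).1 (G.2.2.1 x hx).2,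
    by
      simp only [Finset.forall_mem_image]
      exact fun x hx y hy ↦ hf.comparable x y (G.2.2.1 x hx).1 (G.2.2.1 x hx).2
        (G.2.2.1 y hy).1 (G.2.2.1 y hy).2 (G.2.2.2 x hx y hy)⟩)
    (fun _ _ h ↦ Finset.image_subset_image h)

/-- The union of the images of a chain under two contiguous maps. -/
def chainUnion {f g : ℕ × ℕ → ℕ × ℕ} (hf : Contiguous S q f f) (hg : Contiguous S q g g)
    (hfg : Contiguous S q f g) : ChainPoset S q ⥤ ChainPoset S q :=
  Monotone.functor (f := fun G ↦ ⟨G.1.image f ∪ G.1.image g, (G.2.1.image f).inl,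
    by
      intro x hx
      simp only [Finset.mem_union, Finset.mem_image] at hx
      obtain ⟨x, hx, rfl⟩ | ⟨x, hx, rfl⟩ := hx
      · exact hf.mem x (G.2.2.1 x hx).1 (G.2.2.1 x hx).2
      · exact hg.mem x (G.2.2.1 x hx).1 (G.2.2.1 x hx).2,
    by
      have key {f g : ℕ × ℕ → ℕ × ℕ} (h : Contiguous S q f g) (x : ℕ × ℕ) (hx : x ∈ G.1)
          (y : ℕ × ℕ) (hy : y ∈ G.1) : ChainComparable (f x) (g y) :=
        h.comparable x y (G.2.2.1 x hx).1 (G.2.2.1 x hx).2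
          (G.2.2.1 y hy).1 (G.2.2.1 y hy).2 (G.2.2.2 x hx y hy)
      intro x hx y hy
      simp only [Finset.mem_union, Finset.mem_image] at hx hy
      obtain ⟨x, hx, rfl⟩ | ⟨x, hx, rfl⟩ := hx <;> obtain ⟨y, hy, rfl⟩ | ⟨y, hy, rfl⟩ := hy
      · exact key hf x hx y hy
      · exact key hfg x hx y hy
      · exact (key hfg y hy x hx).symm
      · exact key hg x hx y hy⟩)
    (fun _ _ h ↦ Finset.union_subset_union (Finset.image_subset_image h)
      (Finset.image_subset_image h))

/-- Contiguity makes `f(G) ∪ g(G)` a chain, which contains both images naturally in `G`. -/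
lemma nerveHomotopic_chainImage {f g : ℕ × ℕ → ℕ × ℕ} (hf : Contiguous S q f f)
    (hg : Contiguous S q g g) (hfg : Contiguous S q f g) :
    NerveHomotopic (chainImage hf) (chainImage hg) :=
  (nerveHomotopic_of_natTrans (G := chainUnion hf hg hfg)
    { app G := homOfLE (Finset.subset_union_left (s₁ := G.1.image f) (s₂ := G.1.image g)) }).trans
  (nerveHomotopic_of_natTrans (F := chainImage hg) (G := chainUnion hf hg hfg)
    { app G := homOfLE (Finset.subset_union_right (s₁ := G.1.image f) (s₂ := G.1.image g)) }).symm

/-- Push the points `(t, a)` with `a < k` down to `t ≤ a + 1`. -/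
def lowerPoints (k : ℕ) (x : ℕ × ℕ) : ℕ × ℕ :=
  (if x.2 < k then min x.1 (x.2 + 1) else x.1, x.2)

/-- Push the points `(t, a)` down to `t ≤ a + 1`, and to `t = a + 1` if `k ≤ a`. -/
def diagonalPoints (k : ℕ) (x : ℕ × ℕ) : ℕ × ℕ :=
  (if x.2 < k then min x.1 (x.2 + 1) else x.2 + 1, x.2)

variable (S q) in
/-- The condition on `S` that makes the complex of chains contractible. -/
structure IsChainRange : Prop where
  pos {t : ℕ} (ht : t ∈ S) : 1 ≤ t
  down {s t : ℕ} (ht : t ∈ S) (hs : 1 ≤ s) (hst : s ≤ t) : s ∈ S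
  succ_mem {a : ℕ} (ha : a ≤ q) : a + 1 ∈ S

/-- Passing from `k` to `k + 1` moves only row `k`. Points of one row are always comparable, and the
rows below already satisfy `t ≤ a + 1`. Moving several rows at once can destroy comparability. -/
lemma contiguous_lowerPoints (h : IsChainRange S q) {k l : ℕ} (hkl : k ≤ l) (hlk : l ≤ k + 1) :
    Contiguous S q (lowerPoints k) (lowerPoints l) where
  mem x hx hx' := by
    have := h.pos hx
    unfold lowerPoints
    refine ⟨?_, hx'⟩
    dsimp only
    split_ifs
    · exact h.down hx (by omega) (by omega)
    · exact hx
  comparable x y hx hx' hy hy' hxy := by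
    unfold ChainComparable lowerPoints
    unfold ChainComparable at hxy
    dsimp only
    split_ifs <;> omega

/-- Passing from `k + 1` to `k` puts row `k` on the diagonal. The rows below satisfy `t ≤ a + 1 < k
+ 1`, and the rows above are already on the diagonal. -/
lemma contiguous_diagonalPoints (h : IsChainRange S q) {k l : ℕ} (hkl : k ≤ l)
    (hlk : l ≤ k + 1) : Contiguous S q (diagonalPoints k) (diagonalPoints l) where
  mem x hx hx' := by
    have := h.pos hx
    unfold diagonalPoints
    refine ⟨?_, hx'⟩
    dsimp only
    split_ifs
    · exact h.down hx (by omega) (by omega)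
    · exact h.succ_mem hx'
  comparable x y hx hx' hy hy' hxy := by
    unfold ChainComparable diagonalPoints
    unfold ChainComparable at hxy
    dsimp only
    split_ifs <;> omega

lemma nerveHomotopic_lowerPoints (h : IsChainRange S q) (k : ℕ) :
    NerveHomotopic (chainImage (contiguous_lowerPoints h le_rfl k.le_succ))
      (chainImage (contiguous_lowerPoints h le_rfl (Nat.le_succ 0))) := by
  induction k with
  | zero => exact nerveHomotopic_of_natTrans (𝟙 _)
  | succ k ih =>
    exact (nerveHomotopic_chainImage _ _
      (contiguous_lowerPoints h k.le_succ le_rfl)).symm.trans ih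

lemma nerveHomotopic_diagonalPoints (h : IsChainRange S q) (k : ℕ) :
    NerveHomotopic (chainImage (contiguous_diagonalPoints h le_rfl k.le_succ))
      (chainImage (contiguous_diagonalPoints h le_rfl (Nat.le_succ 0))) := by
  induction k with
  | zero => exact nerveHomotopic_of_natTrans (𝟙 _)
  | succ k ih =>
    exact (nerveHomotopic_chainImage _ _
      (contiguous_diagonalPoints h k.le_succ le_rfl)).symm.trans ih

/-- The chain consisting of the point `(1, 0)`. -/
def baseChain (h : IsChainRange S q) : ChainPoset S q :=
  ⟨{(1, 0)}, Finset.singleton_nonempty _, by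
    simpa using h.succ_mem (Nat.zero_le q), by simp [ChainComparable]⟩

lemma nerveHomotopic_chainPoset (h : IsChainRange S q) :
    NerveHomotopic (𝟭 (ChainPoset S q)) ((Functor.const _).obj (baseChain h)) := by
  have hc : Contiguous S q (fun _ ↦ (1, 0)) (fun _ ↦ (1, 0)) :=
    ⟨fun _ _ _ ↦ ⟨h.succ_mem (Nat.zero_le q), Nat.zero_le q⟩, fun _ _ _ _ _ _ _ ↦ Or.inl ⟨rfl, rfl⟩⟩
  have hc' : Contiguous S q (diagonalPoints 0) (fun _ ↦ (1, 0)) := by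
    refine ⟨(contiguous_diagonalPoints h le_rfl (Nat.le_succ 0)).mem, fun x y _ _ _ _ _ ↦ ?_⟩
    unfold ChainComparable diagonalPoints
    dsimp only
    split_ifs <;> omega
  -- `lowerPoints 0` fixes every point, and `q + 1` steps treat all the rows `0, …, q`.
  refine ((nerveHomotopic_of_natTrans
    (G := chainImage (contiguous_lowerPoints h le_rfl (Nat.le_succ 0)))
      { app G := homOfLE fun x hx ↦ Finset.mem_image.2 ⟨x, hx, by simp [lowerPoints]⟩ }).trans
    ((nerveHomotopic_lowerPoints h (q + 1)).symm.trans ?_))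
  -- All rows have `a < q + 1`, where `lowerPoints (q + 1)` and `diagonalPoints (q + 1)` agree.
  refine NerveHomotopic.trans (nerveHomotopic_of_natTrans
    (G := chainImage (contiguous_diagonalPoints h le_rfl (q + 1).le_succ))
      { app G := homOfLE (Finset.image_subset_iff.2 fun x hx ↦ Finset.mem_image.2 ⟨x, hx, by
          have := (G.2.2.1 x hx).2
          simp [lowerPoints, diagonalPoints, Nat.lt_succ_of_le this]⟩) }) ?_
  -- `diagonalPoints 0` sends `(t, a)` to `(a + 1, a)`, which is always comparable to `(1, 0)`.
  refine (nerveHomotopic_diagonalPoints h (q + 1)).trans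
    ((nerveHomotopic_chainImage _ hc hc').trans (nerveHomotopic_of_natTrans
      { app G := homOfLE (Finset.image_subset_iff.2 fun x _ ↦ Finset.mem_singleton_self _) }))

end ChainMaps

/-! ### Left fibers and chains -/

section Fiber

variable {S : Set ℕ} {q : ℕ}

instance {T U : CostructuredArrow (toSimplex S) ⦋q⦌} : Subsingleton (T ⟶ U) :=
  ⟨fun _ _ ↦ CostructuredArrow.hom_ext _ _ (Subsingleton.elim _ _)⟩

/-- The points of the graph of a map `T ⟶ {0, …, q}`. -/
def graphPoint (x : CostructuredArrow (toSimplex S) ⦋q⦌) (i : Fin ((x.left.1.card - 1) + 1)) :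
    ℕ × ℕ :=
  ((x.left.enum i).1, (x.hom.toOrderHom i).1)

/-- A morphism of the fiber keeps the elements of `T` and their values in `[q]`, so graphs grow by
inclusion. -/
lemma graphPoint_map {x y : CostructuredArrow (toSimplex S) ⦋q⦌} (g : x ⟶ y)
    (i : Fin ((x.left.1.card - 1) + 1)) :
    ∃ j, graphPoint y j = graphPoint x i := by
  refine ⟨((toSimplex S).map g.left).toOrderHom i, Prod.ext ?_ ?_⟩
  · exact congrArg Subtype.val (y.left.enum.apply_symm_apply _)
  · exact congrArg (fun u : (toSimplex S).obj x.left ⟶ ⦋q⦌ ↦ (u.toOrderHom i).1)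
      (CostructuredArrow.w g)

/-- The graph of a map `T ⟶ {0, …, q}`, as a functor to the poset of chains. -/
def graphFunctor (S : Set ℕ) (q : ℕ) :
    CostructuredArrow (toSimplex S) ⦋q⦌ ⥤ ChainPoset S q where
  obj x := ⟨Finset.univ.image (graphPoint x), Finset.univ_nonempty.image _, by
      simp only [Finset.forall_mem_image]
      exact fun i _ ↦ ⟨x.left.2.2 (x.left.enum i).2, Nat.le_of_lt_succ (x.hom.toOrderHom i).2⟩, by
      simp only [Finset.forall_mem_image]
      intro i _ j _
      obtain hij | rfl | hij := lt_trichotomy i j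
      · exact .inr (.inl ⟨x.left.enum.strictMono hij, x.hom.toOrderHom.monotone hij.le⟩)
      · exact .inl ⟨rfl, rfl⟩
      · exact .inr (.inr ⟨x.left.enum.strictMono hij, x.hom.toOrderHom.monotone hij.le⟩)⟩
  map {x y} g := homOfLE (Finset.image_subset_iff.2 fun i _ ↦ by
    obtain ⟨j, hj⟩ := graphPoint_map g i
    exact Finset.mem_image.2 ⟨j, Finset.mem_univ j, hj⟩)

/-- The largest second coordinate of the points of a chain with first coordinate at most `t`. -/
def chainValue (G : Finset (ℕ × ℕ)) (t : ℕ) : ℕ := (G.filter (·.1 ≤ t)).sup Prod.snd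

/-- The supremum is defined at every `t`, with value `0` to the left of all points, so monotonicity
holds for any finite set. -/
lemma chainValue_mono (G : Finset (ℕ × ℕ)) : Monotone (chainValue G) := by
  intro s t hst
  refine Finset.sup_mono fun x hx ↦ ?_
  rw [Finset.mem_filter] at hx ⊢
  exact ⟨hx.1, hx.2.trans hst⟩

/-- In a chain, the points weakly to the left of `x` lie weakly below it. -/
lemma chainValue_eq (G : ChainPoset S q) {x : ℕ × ℕ} (hx : x ∈ G.1) :
    chainValue G.1 x.1 = x.2 := by
  refine le_antisymm (Finset.sup_le fun y hy ↦ ?_) (Finset.le_sup (f := Prod.snd)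
    (Finset.mem_filter.2 ⟨hx, le_rfl⟩))
  obtain ⟨hy, hyx⟩ := Finset.mem_filter.1 hy
  have h := G.2.2.2 x hx y hy
  unfold ChainComparable at h
  omega

/-- The set of first coordinates of a chain. -/
def chainSupport (G : ChainPoset S q) : FinSub S :=
  ⟨G.1.image Prod.fst, G.2.1.image _, fun t ht ↦ by
    obtain ⟨x, hx, rfl⟩ := Finset.mem_image.1 ht
    exact (G.2.2.1 x hx).1⟩

/-- The map `T ⟶ {0, …, q}` whose graph is a given chain. -/
def chainHom (G : ChainPoset S q) : (toSimplex S).obj (chainSupport G) ⟶ ⦋q⦌ :=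
  SimplexCategory.mkHom
    { toFun i := ⟨chainValue G.1 ((chainSupport G).enum i).1, Nat.lt_succ_of_le
        (Finset.sup_le fun x hx ↦ (G.2.2.1 x (Finset.mem_filter.1 hx).1).2)⟩
      monotone' _ _ hij := chainValue_mono G.1 ((chainSupport G).enum.monotone hij) }

lemma chainHom_comp {G : ChainPoset S q} {T : FinSub S} (g : chainSupport G ⟶ T)
    (u : (toSimplex S).obj T ⟶ ⦋q⦌)
    (h : ∀ x ∈ G.1, ∀ j, (T.enum j).1 = x.1 → (u.toOrderHom j).1 = x.2) :
    (toSimplex S).map g ≫ u = chainHom G := by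
  ext i : 3
  apply Fin.ext
  obtain ⟨x, hx, hxi⟩ := Finset.mem_image.1 ((chainSupport G).enum i).2
  change (u.toOrderHom (((toSimplex S).map g).toOrderHom i)).1 =
    chainValue G.1 ((chainSupport G).enum i).1
  rw [← hxi, chainValue_eq G hx]
  exact h x hx _ ((congrArg Subtype.val (T.enum.apply_symm_apply _)).trans hxi.symm)

lemma chainHom_apply (G : ChainPoset S q) (x : ℕ × ℕ) (hx : x ∈ G.1)
    (j : Fin (((chainSupport G).1.card - 1) + 1)) (hj : ((chainSupport G).enum j).1 = x.1) :
    ((chainHom G).toOrderHom j).1 = x.2 := by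
  change chainValue G.1 ((chainSupport G).enum j).1 = x.2
  rw [hj, chainValue_eq G hx]

/-- A chain, viewed as the graph of a map `T ⟶ {0, …, q}`. -/
def chainArrow (S : Set ℕ) (q : ℕ) :
    ChainPoset S q ⥤ CostructuredArrow (toSimplex S) ⦋q⦌ where
  obj G := CostructuredArrow.mk (chainHom G)
  map {G G'} g := CostructuredArrow.homMk
    (homOfLE (Finset.image_subset_image (leOfHom g)) : chainSupport G ⟶ chainSupport G')
    (chainHom_comp _ _ fun x hx ↦ chainHom_apply G' x (leOfHom g hx))

/-- The graph determines the map. -/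
def graphChain (S : Set ℕ) (q : ℕ) : graphFunctor S q ⋙ chainArrow S q ⟶ 𝟭 _ where
  app x := CostructuredArrow.homMk
    (homOfLE (by
      intro t ht
      obtain ⟨z, hz, rfl⟩ := Finset.mem_image.1 ht
      obtain ⟨i, -, rfl⟩ := Finset.mem_image.1 hz
      exact (x.left.enum i).2) : chainSupport ((graphFunctor S q).obj x) ⟶ x.left)
    (chainHom_comp _ _ fun z hz j hj ↦ by
      obtain ⟨i, -, rfl⟩ := Finset.mem_image.1 hz
      obtain rfl : j = i := x.left.enum.injective (Subtype.ext hj)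
      rfl)
  naturality _ _ _ := Subsingleton.elim _ _

end Fiber

/-! ### Left cofinality -/

lemma isLeftCofinal_toDelta : IsLeftCofinal toDelta := fun c ↦
  isContractible_nerve_of_retract (graphFunctor (Set.Ici 1) c.len) (chainArrow _ _)
    (graphChain _ _) (nerveHomotopic_chainPoset
      { pos ht := ht
        down _ hs _ := hs
        succ_mem _ := Nat.succ_pos _ })

/-- As `Δ^{<n}` is a full subcategory, the fiber over `c` is equivalent to the fiber of `toSimplex`
over `c.obj`. -/
lemma isLeftCofinal_toDeltaLT (n : ℕ) : IsLeftCofinal (toDeltaLT n) := fun c ↦ by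
  let e := CostructuredArrow.post (toDeltaLT n) (ObjectProperty.ι _) c
  have h : IsChainRange (Set.Icc 1 n) c.obj.len :=
    { pos ht := ht.1
      down ht hs hst := ⟨hs, hst.trans ht.2⟩
      -- The diagonal point of row `a` exists because `a ≤ q < n` gives `a + 1 ≤ n`.
      succ_mem ha := ⟨Nat.succ_pos _, lt_of_le_of_lt ha c.property⟩ }
  exact isContractible_nerve_of_retract (e ⋙ graphFunctor (Set.Icc 1 n) c.obj.len)
    (chainArrow _ _ ⋙ e.inv)
    (Functor.whiskerRight (Functor.whiskerLeft e (graphChain _ _)) e.inv ≫ e.asEquivalence.unitInv)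
    (nerveHomotopic_chainPoset h)

end

end CosimplicialDescent

theorem mainTheorem7 :
    (IsLeftCofinal toDelta ∧ ∀ n : ℕ, 1 ≤ n → IsLeftCofinal (toDeltaLT n)) ∧
    (∀ (Y Y' : SimplexCategory ⥤ Spectrum) (r : Y ⟶ Y'), IsFibrantReplacement r →
      Spectrum.IsStableEquiv (holimRestrict toDelta Y')) ∧
    (∀ n : ℕ, 1 ≤ n → ∀ (Y Y' : DeltaLT n ⥤ Spectrum) (r : Y ⟶ Y'), IsFibrantReplacement r →
      Spectrum.IsStableEquiv (holimRestrict (toDeltaLT n) Y')) := by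
  refine ⟨⟨isLeftCofinal_toDelta, fun n _ ↦ isLeftCofinal_toDeltaLT n⟩, fun _ Y' _ hr ↦ ?_,
    fun n _ _ Y' _ hr ↦ ?_⟩
  · exact isLeftCofinal_toDelta.isStableEquiv_holimRestrict Y' fun c ↦ (hr c).1.1
  · exact (isLeftCofinal_toDeltaLT n).isStableEquiv_holimRestrict Y' fun c ↦ (hr c).1.1
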